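/- **Setting.** A *profinite space* is a simplicial object in profinite sets (compact, Hausdorff, totally disconnected spaces); $\hat{\mathcal S}$ is their category. The profinite completion of a set $X$ is $\hat X=\lim_R X/R$, over all equivalence relations $R$ on $X$ with finitely many classes; applied degreewise it sends a simplicial set $Z$ to a profinite space $\hat Z$, and it is left adjoint to the forgetful functor. For a profinite space $X$, $\pi_0(X)$ is the coequalizer of $d_0,d_1:X_1\rightrightarrows X_0$ in profinite sets. A *finite covering* of $X$ is a map of profinite spaces $E\to X$ that is a local homeomorphism in each degree and in which every simplex of $X$ lifts uniquely once a lift of one of its vertices is given. The universal profinite covering $(\tilde X,x)$ at a vertex $x\in X_0$ is the limit of all finite coverings $E$ pointed by an element of the fibre over $x$. The fundamental groupoid $\Pi X$ has the vertices of $X$ as objects and the isomorphisms between the fibre functors of the finite coverings at $x$ and at $y$ (equivalently, the isomorphisms over $X$ between the universal profinite coverings) as morphisms $x\to y$; the profinite group of automorphisms of $x$ is $\pi_1(X,x)$. A *local coefficient system* $\mathcal M$ of finite abelian groups on $X$ is a functor from $\Pi X$ to finite abelian groups such that each $\pi_1(X,x)$ acts continuously on the discrete group $\mathcal M(x)$;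 $H^*_{\mathrm{cts}}(X;\mathcal M)$ is the cohomology of the complex $\hom_{\Pi X}((\tilde X,-),\mathcal M)$ of continuous natural transformations. A map $f:X\to Y$ in $\hat{\mathcal S}$ is a *weak equivalence* if it induces an isomorphism $\pi_0(X)\to\pi_0(Y)$ of profinite sets, an isomorphism $\pi_1(X,x)\to\pi_1(Y,f(x))$ of profinite groups for every vertex $x\in X_0$, and isomorphisms $H^q_{\mathrm{cts}}(Y;\mathcal M)\to H^q_{\mathrm{cts}}(X;f^*\mathcal M)$ for every $q\ge 0$ and every local coefficient system $\mathcal M$ of finite abelian groups on $Y$. Let $G$ be an abstract group and let $\hat G=\lim_U G/U$, over the normal subgroups $U$ of finite index, be its profinite completion. Let $BG$ be the simplicial classifying space of $G$, with $(BG)_n=G^n$, and let $B\hat G\in\hat{\mathcal S}$ be the classifying space of $\hat G$, with $(B\hat G)_n=\hat G^{\,n}$ as a profinite set. Let $\varphi:\widehat{BG}\to B\hat G$ be the canonical map in $\hat{\mathcal S}$, i.e. the unique one whose composition with $BG\to\widehat{BG}$ is the map $BG\to B\hat G$ induced by $G\to\hat G$. The group $G$ is *good* (in the sense of Serre) if the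 map $H^q_{\mathrm{cts}}(\hat G;M)\to H^q(G;M)$ from continuous to discrete group cohomology, induced by $G\to\hat G$, is an isomorphism for every finite discrete $\hat G$-module $M$ and every $q\ge 0$. **Proposition.** For every abstract group $G$, the map $\varphi:\widehat{BG}\to B\hat G$ is a weak equivalence in $\hat{\mathcal S}$ if and only if $G$ is good. -/

import Mathlib

open CategoryTheory Opposite Simplicial

universe u

namespace ProfiniteSpace

noncomputable section

/-! ### Profinite completion of sets and of simplicial sets -/

/-- The equivalence relations on `X` with finitely many classes. -/
structure FiniteQuotient (X : Type u) : Type u where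
  /-- The equivalence relation. -/
  rel : Setoid X
  /-- The quotient is finite. -/
  finite : Finite (Quotient rel)

namespace FiniteQuotient

/-- The finite set `X/R`, with the discrete topology. -/
def Classes {X : Type u} (R : FiniteQuotient X) : Type u := Quotient R.rel

instance {X : Type u} (R : FiniteQuotient X) : TopologicalSpace R.Classes := ⊥

instance {X : Type u} (R : FiniteQuotient X) : DiscreteTopology R.Classes := ⟨rfl⟩

instance {X : Type u} (R : FiniteQuotient X) : Finite R.Classes := R.finite

/-- The class of an element. -/
def cls {X : Type u} (R : FiniteQuotient X) (x : X) : R.Classes := Quotient.mk R.rel x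

/-- The projection `X/R → X/S` for `R ⊆ S`. -/
def proj {X : Type u} {R S : FiniteQuotient X} (h : R.rel ≤ S.rel) : R.Classes → S.Classes :=
  Setoid.map_of_le h

/-- The inverse image of an equivalence relation under a map. -/
def comap {X Y : Type u} (f : X → Y) (R : FiniteQuotient Y) : FiniteQuotient X :=
  ⟨Setoid.comap f R.rel, by
    have := R.finite
    refine Finite.of_injective
      (Quotient.lift (fun x => Quotient.mk R.rel (f x)) fun a b h => Quotient.sound h) ?_
    rintro ⟨a⟩ ⟨b⟩ h
    exact Quotient.sound (Quotient.exact h : R.rel (f a) (f b))⟩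

/-- The map `X/f⁻¹R → Y/R` induced by `f : X → Y`. -/
def map {X Y : Type u} (f : X → Y) (R : FiniteQuotient Y) : (comap f R).Classes → R.Classes :=
  Quotient.lift (fun x => R.cls (f x)) fun _ _ h => Quotient.sound h

end FiniteQuotient

/-- The profinite completion `lim_R X/R` of a set `X`: the compatible families of classes, for
all equivalence relations `R` on `X` with finite quotient. -/
def SetCompletion (X : Type u) : Type u :=
  {t : ∀ R : FiniteQuotient X, R.Classes //
    ∀ (R S : FiniteQuotient X) (h : R.rel ≤ S.rel), FiniteQuotient.proj h (t R) = t S}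

namespace SetCompletion

instance (X : Type u) : TopologicalSpace (SetCompletion X) := instTopologicalSpaceSubtype

instance (X : Type u) : T2Space (SetCompletion X) :=
  inferInstanceAs (T2Space {t : ∀ R : FiniteQuotient X, R.Classes //
    ∀ (R S : FiniteQuotient X) (h : R.rel ≤ S.rel), FiniteQuotient.proj h (t R) = t S})

instance (X : Type u) : TotallyDisconnectedSpace (SetCompletion X) :=
  inferInstanceAs (TotallyDisconnectedSpace {t : ∀ R : FiniteQuotient X, R.Classes //
    ∀ (R S : FiniteQuotient X) (h : R.rel ≤ S.rel), FiniteQuotient.proj h (t R) = t S})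

instance (X : Type u) : CompactSpace (SetCompletion X) := by
  refine isCompact_iff_compactSpace.mp (IsClosed.isCompact (X := ∀ R : FiniteQuotient X, R.Classes)
    (s := {t | ∀ (R S : FiniteQuotient X) (h : R.rel ≤ S.rel), FiniteQuotient.proj h (t R) = t S}) ?_)
  simp only [Set.ofPred_forall]
  refine isClosed_iInter fun R => isClosed_iInter fun S => isClosed_iInter fun h => ?_
  exact isClosed_eq (continuous_of_discreteTopology.comp (continuous_apply R)) (continuous_apply S)

/-- The canonical map from a set to its profinite completion. -/
def unit {X : Type u} (x : X) : SetCompletion X := ⟨fun R => R.cls x, fun _ _ _ => rfl⟩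

/-- The map of completions induced by a map of sets. -/
def map {X Y : Type u} (f : X → Y) (t : SetCompletion X) : SetCompletion Y :=
  ⟨fun R => R.map f (t.1 (R.comap f)), fun R S h => by
    have h' : (R.comap f).rel ≤ (S.comap f).rel := fun a b hab => h hab
    change FiniteQuotient.proj h (R.map f (t.1 (R.comap f))) = S.map f (t.1 (S.comap f))
    rw [← t.2 _ _ h']
    generalize t.1 (R.comap f) = c
    obtain ⟨x, rfl⟩ := Quotient.exists_rep c
    rfl⟩

lemma continuous_map {X Y : Type u} (f : X → Y) : Continuous (map f) :=
  Continuous.subtype_mk (continuous_pi fun R => continuous_of_discreteTopology.comp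
    ((continuous_apply (R.comap f)).comp continuous_subtype_val)) _

lemma denseRange_unit (X : Type u) : DenseRange (unit (X := X)) := by
  rw [DenseRange, dense_iff_inter_open]
  rintro U ⟨V, hV, rfl⟩ ⟨t, ht⟩
  obtain ⟨I, W, hW, hIV⟩ := isOpen_pi_iff.mp hV _ ht
  -- a common refinement of finitely many equivalence relations
  let R : FiniteQuotient X := ⟨Setoid.ker fun x (i : I) => i.1.cls x,
    Finite.of_injective _ (Setoid.kerLift_injective _)⟩
  obtain ⟨x, hx⟩ := Quotient.exists_rep (t.1 R)
  refine ⟨unit x, hIV fun i hi => ?_, x, rfl⟩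
  have h : R.rel ≤ i.rel := fun a b hab => Quotient.exact (congrFun hab ⟨i, hi⟩)
  have : (unit x).1 i = t.1 i := by rw [← t.2 R i h, ← hx]; rfl
  rw [this]
  exact (hW i hi).2

lemma exists_extension {X : Type u} {S : Type u} [TopologicalSpace S] [CompactSpace S] [T2Space S]
    [TotallyDisconnectedSpace S] (f : X → S) :
    ∃ F : C(SetCompletion X, S), ∀ x, F (unit x) = f x := by
  -- the equivalence relation on `X` induced by a discrete quotient of `S`
  let K : DiscreteQuotient S → FiniteQuotient X := fun Q =>
    ⟨Setoid.ker fun x => Q.proj (f x), Finite.of_injective _ (Setoid.kerLift_injective _)⟩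
  let k : ∀ Q : DiscreteQuotient S, (K Q).Classes → Q := fun Q => Setoid.kerLift _
  have H : ∀ t : SetCompletion X, ∃ s : S, ∀ Q : DiscreteQuotient S, Q.proj s = k Q (t.1 (K Q)) := by
    intro t
    refine DiscreteQuotient.exists_of_compat (fun Q => k Q (t.1 (K Q))) fun A B h => ?_
    have h' : (K A).rel ≤ (K B).rel := fun a b hab => by
      have := congrArg (DiscreteQuotient.ofLE h) (hab : A.proj (f a) = A.proj (f b))
      simpa using this
    rw [← t.2 _ _ h']
    generalize t.1 (K A) = c
    obtain ⟨x, rfl⟩ := Quotient.exists_rep c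
    rfl
  choose F hF using H
  have hc : Continuous F := by
    rw [(isTopologicalBasis_isClopen (X := S)).continuous_iff]
    intro U hU
    let Q := DiscreteQuotient.ofIsClopen hU
    have hU' : U = Q.proj ⁻¹' (Q.proj '' U) := by
      refine Set.Subset.antisymm (Set.subset_preimage_image _ _) ?_
      rintro s ⟨s', hs', h⟩
      have h2 : (s' ∈ U ↔ s ∈ U) := Quotient.exact h
      exact h2.1 hs'
    have : F ⁻¹' U = (fun t : SetCompletion X => t.1 (K Q)) ⁻¹' ((k Q) ⁻¹' (Q.proj '' U)) := by
      ext t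
      rw [hU']
      simp only [Set.mem_preimage, hF]
      rw [← hU']
    rw [this]
    exact (isOpen_discrete _).preimage ((continuous_apply _).comp continuous_subtype_val)
  refine ⟨⟨F, hc⟩, fun x => DiscreteQuotient.eq_of_forall_proj_eq fun Q => ?_⟩
  exact hF (unit x) Q

/-- The continuous extension to the profinite completion of a map from a set to a profinite
set. -/
def extend {X : Type u} {S : Profinite.{u}} (f : X → S) :
    Profinite.of (SetCompletion X) ⟶ S :=
  CompHausLike.ofHom _ (exists_extension f).choose

lemma extend_unit {X : Type u} {S : Profinite.{u}} (f : X → S) (x : X) :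
    extend f (unit x) = f x :=
  (exists_extension f).choose_spec x

lemma hom_ext {X : Type u} {S : Profinite.{u}} {F F' : Profinite.of (SetCompletion X) ⟶ S}
    (h : ∀ x, F (unit x) = F' (unit x)) : F = F' := by
  ext t
  exact congrFun ((denseRange_unit X).equalizer F.hom.hom.continuous F'.hom.hom.continuous
    (funext h)) t

end SetCompletion

/-- The functor sending a set to its profinite completion. -/
def setCompletion : Type u ⥤ Profinite.{u} where
  obj X := Profinite.of (SetCompletion X)
  map f := CompHausLike.ofHom _ ⟨SetCompletion.map f, SetCompletion.continuous_map f⟩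
  map_id _ := SetCompletion.hom_ext fun _ => rfl
  map_comp _ _ := SetCompletion.hom_ext fun _ => rfl

/-- The set-theoretic profinite completion of a simplicial set: the completion of sets applied in
each degree. -/
def completion : SSet.{u} ⥤ SimplicialObject Profinite.{u} :=
  (SimplicialObject.whiskering _ _).obj setCompletion

/-! ### Classifying spaces -/

/-- The simplicial structure of the classifying space of a group `Γ`: the operator `Γⁿ → Γᵐ`
attached to `θ : [m] → [n]` sends `(g₁, …, gₙ)` to the tuple with `i`-th entry
`g_{θ(i-1)+1} ⋯ g_{θ(i)}`. In particular `d₀` and `dₙ` omit the first and the last entry, the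
other `dᵢ` multiply two consecutive entries and the degeneracies insert `1`. -/
def barMap {Γ : Type u} [Group Γ] {m n : SimplexCategory} (θ : m ⟶ n) (g : Fin n.len → Γ) :
    Fin m.len → Γ :=
  fun i => (Fin.partialProd g (θ.toOrderHom i.castSucc))⁻¹ *
    Fin.partialProd g (θ.toOrderHom i.succ)

lemma partialProd_barMap {Γ : Type u} [Group Γ] {m n : SimplexCategory} (θ : m ⟶ n)
    (g : Fin n.len → Γ) (i : Fin (m.len + 1)) :
    Fin.partialProd (barMap θ g) i =
      (Fin.partialProd g (θ.toOrderHom 0))⁻¹ * Fin.partialProd g (θ.toOrderHom i) := by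
  induction i using Fin.induction with
  | zero => simp
  | succ i ih => rw [Fin.partialProd_succ, ih, barMap]; group

lemma barMap_id {Γ : Type u} [Group Γ] {n : SimplexCategory} (g : Fin n.len → Γ) :
    barMap (𝟙 n) g = g := by
  funext i
  exact Fin.partialProd_right_inv g i

lemma barMap_comp {Γ : Type u} [Group Γ] {l m n : SimplexCategory} (η : l ⟶ m) (θ : m ⟶ n)
    (g : Fin n.len → Γ) : barMap (η ≫ θ) g = barMap η (barMap θ g) := by
  funext i
  change (Fin.partialProd g (θ.toOrderHom (η.toOrderHom i.castSucc)))⁻¹ *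
      Fin.partialProd g (θ.toOrderHom (η.toOrderHom i.succ)) =
    (Fin.partialProd (barMap θ g) (η.toOrderHom i.castSucc))⁻¹ *
      Fin.partialProd (barMap θ g) (η.toOrderHom i.succ)
  rw [partialProd_barMap, partialProd_barMap]
  group

lemma barMap_hom {Γ Δ : Type u} [Group Γ] [Group Δ] (f : Γ →* Δ) {m n : SimplexCategory}
    (θ : m ⟶ n) (g : Fin n.len → Γ) : barMap θ (f ∘ g) = f ∘ barMap θ g := by
  have key : ∀ i, Fin.partialProd (f ∘ g) i = f (Fin.partialProd g i) := by
    intro i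
    induction i using Fin.induction with
    | zero => simp
    | succ i ih => simp [Fin.partialProd_succ, ih]
  funext i
  simp [barMap, key]

lemma continuous_barMap {Γ : Type u} [Group Γ] [TopologicalSpace Γ] [IsTopologicalGroup Γ]
    {m n : SimplexCategory} (θ : m ⟶ n) : Continuous (barMap (Γ := Γ) θ) := by
  have key : ∀ i, Continuous fun g : Fin n.len → Γ => Fin.partialProd g i := by
    intro i
    induction i using Fin.induction with
    | zero => simpa using continuous_const
    | succ i ih =>
      simp only [Fin.partialProd_succ]
      exact ih.mul (continuous_apply i)
  exact continuous_pi fun i => (key _).inv.mul (key _)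

/-- The classifying space `BG` of a group, with `n`-simplices `Gⁿ`. -/
def classifyingSpace (G : Type u) [Group G] : SSet.{u} where
  obj n := Fin n.unop.len → G
  map θ := TypeCat.ofHom (barMap θ.unop)
  map_id _ := ConcreteCategory.hom_ext _ _ fun g => barMap_id g
  map_comp θ η := ConcreteCategory.hom_ext _ _ fun g => barMap_comp η.unop θ.unop g

/-- The classifying space of a profinite group `Γ`, with `Γⁿ` as profinite set of
`n`-simplices. -/
def profiniteClassifyingSpace (Γ : ProfiniteGrp.{u}) : SimplicialObject Profinite.{u} where
  obj n := Profinite.of (Fin n.unop.len → Γ)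
  map θ := CompHausLike.ofHom _ ⟨barMap θ.unop, continuous_barMap θ.unop⟩
  map_id _ := ConcreteCategory.hom_ext _ _ fun g => barMap_id g
  map_comp θ η := ConcreteCategory.hom_ext _ _ fun g => barMap_comp η.unop θ.unop g

/-- The profinite completion `Ĝ` of a group. -/
abbrev groupCompletion (G : Type u) [Group G] : ProfiniteGrp.{u} :=
  ProfiniteGrp.profiniteCompletion.obj (GrpCat.of G)

/-- The canonical homomorphism `G → Ĝ`. -/
def toGroupCompletion (G : Type u) [Group G] : G →* groupCompletion G :=
  (ProfiniteGrp.ProfiniteCompletion.eta (GrpCat.of G)).hom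

/-- The canonical map `φ` from the set-theoretic completion of `BG` to `BĜ`: the one extending
`BG → BĜ`. -/
def comparison (G : Type u) [Group G] :
    completion.obj (classifyingSpace G) ⟶ profiniteClassifyingSpace (groupCompletion G) where
  app n := SetCompletion.extend (X := Fin n.unop.len → G)
    (S := Profinite.of (Fin n.unop.len → groupCompletion G)) fun g => toGroupCompletion G ∘ g
  naturality m n θ := by
    refine SetCompletion.hom_ext fun g => ?_
    refine (SetCompletion.extend_unit _ (barMap θ.unop g)).trans ?_
    refine Eq.trans ?_ (congrArg (barMap θ.unop)
      (SetCompletion.extend_unit (S := Profinite.of (Fin m.unop.len → groupCompletion G))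
        (fun g => toGroupCompletion G ∘ g) g).symm)
    exact (barMap_hom (toGroupCompletion G) θ.unop g).symm

/-- The map `φ` extends the map `BG → BĜ` given in degree `n` by `Gⁿ → Ĝⁿ`. -/
lemma comparison_unit (G : Type u) [Group G] (n : SimplexCategoryᵒᵖ) (g : Fin n.unop.len → G) :
    (comparison G).app n (SetCompletion.unit g) = toGroupCompletion G ∘ g :=
  SetCompletion.extend_unit (S := Profinite.of (Fin n.unop.len → groupCompletion G)) _ g

/-! ### Connected components, finite coverings, fundamental groupoid -/

/-- `π₀ X`, the coequalizer of `d₀, d₁ : X₁ ⇉ X₀` in profinite sets. -/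
abbrev pi0 (X : SimplicialObject Profinite.{u}) : Profinite.{u} :=
  Limits.coequalizer (X.δ (0 : Fin 2)) (X.δ (1 : Fin 2))

/-- The map induced on `π₀`. -/
def pi0Map {X Y : SimplicialObject Profinite.{u}} (f : X ⟶ Y) : pi0 X ⟶ pi0 Y :=
  Limits.coequalizer.desc (f.app (op ⦋0⦌) ≫ Limits.coequalizer.π (Y.δ (0 : Fin 2)) (Y.δ 1)) (by
    rw [← Category.assoc, ← Category.assoc, SimplicialObject.δ_naturality,
      SimplicialObject.δ_naturality, Category.assoc, Category.assoc, Limits.coequalizer.condition])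

/-- A finite covering `E → X` of a profinite space: a map such that, for every vertex
`ι : Δ[0] → Δ[n]`, every square from `ι` to `E → X` has a unique filler `Δ[n] → E`, and which is
in each degree a local homeomorphism of profinite sets (so that its fibres are finite and it is
locally trivial). -/
structure FiniteCovering (X : SimplicialObject Profinite.{u}) where
  /-- The total space. -/
  total : SimplicialObject Profinite.{u}
  /-- The projection. -/
  proj : total ⟶ X
  /-- Unique lifting of simplices along a vertex. -/
  existsUnique_lift : ∀ (n : SimplexCategory) (ι : ⦋0⦌ ⟶ n) (σ : X.obj (op n))
    (e : total.obj (op ⦋0⦌)), proj.app (op ⦋0⦌) e = X.map ι.op σ →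
      ∃! τ : total.obj (op n), proj.app (op n) τ = σ ∧ total.map ι.op τ = e
  /-- The projection is a local homeomorphism in each degree. -/
  isLocalHomeomorph : ∀ n : SimplexCategoryᵒᵖ, IsLocalHomeomorph (proj.app n)

namespace FiniteCovering

/-- A morphism of coverings is a map of profinite spaces over `X`. -/
@[ext]
structure Hom {X : SimplicialObject Profinite.{u}} (E E' : FiniteCovering X) where
  /-- The map of total spaces. -/
  map : E.total ⟶ E'.total
  /-- It lies over `X`. -/
  w : map ≫ E'.proj = E.proj

instance (X : SimplicialObject Profinite.{u}) : Category (FiniteCovering X) where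
  Hom := Hom
  id E := ⟨𝟙 _, Category.id_comp _⟩
  comp h k := ⟨h.map ≫ k.map, by rw [Category.assoc, k.w, h.w]⟩

lemma w_apply {X : SimplicialObject Profinite.{u}} {E E' : FiniteCovering X} (h : E ⟶ E')
    (n : SimplexCategoryᵒᵖ) (e : E.total.obj n) :
    E'.proj.app n (h.map.app n e) = E.proj.app n e :=
  ConcreteCategory.congr_hom (NatTrans.congr_app h.w n) e

/-- The fibre of a covering over a vertex `x`. -/
abbrev Fiber {X : SimplicialObject Profinite.{u}} (E : FiniteCovering X) (x : X.obj (op ⦋0⦌)) :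
    Type u :=
  {e : E.total.obj (op ⦋0⦌) // E.proj.app (op ⦋0⦌) e = x}

instance {X : SimplicialObject Profinite.{u}} (E : FiniteCovering X) (x : X.obj (op ⦋0⦌)) :
    Finite (E.Fiber x) := by
  have hl : IsLocalHomeomorph (E.proj.app (op ⦋0⦌)) := E.isLocalHomeomorph _
  have hc : IsClosed {e | E.proj.app (op ⦋0⦌) e = x} :=
    isClosed_singleton.preimage hl.continuous
  have h1 : CompactSpace (E.Fiber x) := isCompact_iff_compactSpace.mp hc.isCompact
  have h2 : DiscreteTopology (E.Fiber x) := by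
    rw [discreteTopology_iff_isOpen_singleton]
    rintro ⟨e, rfl⟩
    obtain ⟨U, hU, heU⟩ := hl e
    refine ⟨U.source, U.open_source, ?_⟩
    ext ⟨e', he'⟩
    simp only [Set.mem_preimage, Set.mem_singleton_iff, Subtype.mk.injEq]
    exact ⟨fun h => U.injOn h hU (by rw [← heU, he']), fun h => h ▸ hU⟩
  exact finite_of_compact_of_discrete

/-- The map induced on fibres by a morphism of coverings. -/
def fiberMap {X : SimplicialObject Profinite.{u}} {E E' : FiniteCovering X} (h : E ⟶ E')
    {x : X.obj (op ⦋0⦌)} (e : E.Fiber x) : E'.Fiber x :=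
  ⟨h.map.app (op ⦋0⦌) e.1, by rw [w_apply, e.2]⟩

/-- The fibre functor at a vertex `x`. -/
abbrev fiberFunctor {X : SimplicialObject Profinite.{u}} (x : X.obj (op ⦋0⦌)) :
    FiniteCovering X ⥤ FintypeCat.{u} where
  obj E := FintypeCat.of (E.Fiber x)
  map h := FintypeCat.homMk (fiberMap h)

/-- The points of the pullback of a finite covering of `Y` along `f : X ⟶ Y`. -/
def PullbackObj {X Y : SimplicialObject Profinite.{u}} (f : X ⟶ Y) (E : FiniteCovering Y)
    (n : SimplexCategoryᵒᵖ) : Type u :=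
  {p : X.obj n × E.total.obj n // f.app n p.1 = E.proj.app n p.2}

section

variable {X Y : SimplicialObject Profinite.{u}} (f : X ⟶ Y) (E : FiniteCovering Y)
  (n : SimplexCategoryᵒᵖ)

instance : TopologicalSpace (PullbackObj f E n) := instTopologicalSpaceSubtype

instance : T2Space (PullbackObj f E n) :=
  inferInstanceAs (T2Space {p : X.obj n × E.total.obj n // f.app n p.1 = E.proj.app n p.2})

instance : TotallyDisconnectedSpace (PullbackObj f E n) :=
  inferInstanceAs (TotallyDisconnectedSpace
    {p : X.obj n × E.total.obj n // f.app n p.1 = E.proj.app n p.2})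

instance : CompactSpace (PullbackObj f E n) :=
  isCompact_iff_compactSpace.mp (IsClosed.isCompact (isClosed_eq
    ((f.app n).hom.hom.continuous.comp continuous_fst)
    ((E.proj.app n).hom.hom.continuous.comp continuous_snd)))

end

/-- The simplicial structure of the pullback. -/
def PullbackObj.map {X Y : SimplicialObject Profinite.{u}} {f : X ⟶ Y} {E : FiniteCovering Y}
    {m n : SimplexCategoryᵒᵖ} (θ : m ⟶ n) (p : PullbackObj f E m) : PullbackObj f E n :=
  ⟨(X.map θ p.1.1, E.total.map θ p.1.2),
    (ConcreteCategory.congr_hom (f.naturality θ) p.1.1).trans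
      ((congrArg (Y.map θ) p.2).trans
        (ConcreteCategory.congr_hom (E.proj.naturality θ) p.1.2).symm)⟩

lemma PullbackObj.continuous_map {X Y : SimplicialObject Profinite.{u}} {f : X ⟶ Y}
    {E : FiniteCovering Y} {m n : SimplexCategoryᵒᵖ} (θ : m ⟶ n) :
    Continuous (PullbackObj.map (f := f) (E := E) θ) :=
  ((((X.map θ).hom.hom.continuous.comp continuous_fst).prodMk
    ((E.total.map θ).hom.hom.continuous.comp continuous_snd)).comp
      continuous_subtype_val).subtype_mk _

/-- The pullback of the total space of a covering of `Y` along `f : X ⟶ Y`. -/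
def pullbackTotal {X Y : SimplicialObject Profinite.{u}} (f : X ⟶ Y) (E : FiniteCovering Y) :
    SimplicialObject Profinite.{u} where
  obj n := Profinite.of (PullbackObj f E n)
  map θ := CompHausLike.ofHom _ ⟨PullbackObj.map θ, PullbackObj.continuous_map θ⟩
  map_id n := ConcreteCategory.hom_ext _ _ fun (p : PullbackObj f E n) =>
    Subtype.ext (Prod.ext
      (ConcreteCategory.congr_hom (X.map_id n) p.1.1)
      (ConcreteCategory.congr_hom (E.total.map_id n) p.1.2))
  map_comp {m _ _} θ η := ConcreteCategory.hom_ext _ _ fun (p : PullbackObj f E m) =>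
    Subtype.ext (Prod.ext
      (ConcreteCategory.congr_hom (X.map_comp θ η) p.1.1)
      (ConcreteCategory.congr_hom (E.total.map_comp θ η) p.1.2))

/-- The first projection of the pullback. -/
def pullbackFst {X Y : SimplicialObject Profinite.{u}} (f : X ⟶ Y) (E : FiniteCovering Y) :
    pullbackTotal f E ⟶ X where
  app n := CompHausLike.ofHom (X := PullbackObj f E n) _
    ⟨fun p => p.1.1, continuous_fst.comp continuous_subtype_val⟩
  naturality _ _ _ := rfl

/-- The second projection of the pullback. -/
def pullbackSnd {X Y : SimplicialObject Profinite.{u}} (f : X ⟶ Y) (E : FiniteCovering Y) :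
    pullbackTotal f E ⟶ E.total where
  app n := CompHausLike.ofHom (X := PullbackObj f E n) _
    ⟨fun p => p.1.2, continuous_snd.comp continuous_subtype_val⟩
  naturality _ _ _ := rfl

lemma isLocalHomeomorph_fst {X Y : SimplicialObject Profinite.{u}} (f : X ⟶ Y)
    (E : FiniteCovering Y) (n : SimplexCategoryᵒᵖ) :
    IsLocalHomeomorph fun p : PullbackObj f E n => p.1.1 := by
  classical
  have hl : IsLocalHomeomorph (E.proj.app n) := E.isLocalHomeomorph n
  have hf : Continuous (f.app n) := (f.app n).hom.hom.continuous
  intro p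
  obtain ⟨U, hpU, hU⟩ := hl p.1.2
  have hU' : ∀ e, U e = E.proj.app n e := fun e => (congrFun hU e).symm
  have hs : ∀ x, f.app n x ∈ U.target → f.app n x = E.proj.app n (U.symm (f.app n x)) :=
    fun x hx => by rw [← hU', U.right_inv hx]
  let s : X.obj n → PullbackObj f E n := fun x =>
    if hx : f.app n x ∈ U.target then ⟨(x, U.symm (f.app n x)), hs x hx⟩ else p
  have hsx : ∀ x (hx : f.app n x ∈ U.target), s x = ⟨(x, U.symm (f.app n x)), hs x hx⟩ :=
    fun x hx => dif_pos hx
  refine ⟨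
    { toFun := fun p => p.1.1
      invFun := s
      source := {p | p.1.2 ∈ U.source}
      target := {x | f.app n x ∈ U.target}
      map_source' := ?_
      map_target' := ?_
      left_inv' := ?_
      right_inv' := ?_
      open_source := U.open_source.preimage (continuous_snd.comp continuous_subtype_val)
      open_target := U.open_target.preimage hf
      continuousOn_toFun := (continuous_fst.comp continuous_subtype_val).continuousOn
      continuousOn_invFun := ?_ }, hpU, rfl⟩
  · intro q hq
    change f.app n q.1.1 ∈ U.target
    rw [q.2, ← hU']
    exact U.map_source hq
  · intro x hx
    rw [hsx x hx]
    exact U.map_target hx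
  · intro q hq
    have hq' : f.app n q.1.1 = U q.1.2 := by rw [q.2, hU']
    have hx : f.app n q.1.1 ∈ U.target := hq' ▸ U.map_source hq
    rw [hsx _ hx]
    refine Subtype.ext (Prod.ext rfl ?_)
    change U.symm (f.app n q.1.1) = q.1.2
    rw [hq', U.left_inv hq]
  · intro x hx
    rw [hsx x hx]
  · rw [continuousOn_iff_continuous_domRestrict]
    have h : Continuous fun x : {x | f.app n x ∈ U.target} =>
        ((x.1, U.symm (f.app n x.1)) : X.obj n × E.total.obj n) :=
      continuous_subtype_val.prodMk (U.continuousOn_symm.comp_continuous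
        (hf.comp continuous_subtype_val) fun x => x.2)
    refine (h.subtype_mk fun x => hs x.1 x.2).congr fun x => ?_
    exact (hsx x.1 x.2).symm

/-- The pullback of a finite covering along `f : X ⟶ Y`. -/
def pullback {X Y : SimplicialObject Profinite.{u}} (f : X ⟶ Y) (E : FiniteCovering Y) :
    FiniteCovering X where
  total := pullbackTotal f E
  proj := pullbackFst f E
  existsUnique_lift n ι σ (e : PullbackObj f E (op ⦋0⦌)) he := by
    obtain ⟨⟨x, e⟩, hxe⟩ := e
    change x = X.map ι.op σ at he
    subst he
    have h0 := ConcreteCategory.congr_hom (f.naturality ι.op) σ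
    obtain ⟨τ, ⟨h1, h2⟩, h3⟩ := E.existsUnique_lift n ι (f.app (op n) σ) e
      (hxe.symm.trans h0)
    refine ⟨(⟨(σ, τ), h1.symm⟩ : PullbackObj f E (op n)),
      ⟨rfl, Subtype.ext (Prod.ext rfl h2)⟩, ?_⟩
    intro (p : PullbackObj f E (op n)) ⟨h4, h5⟩
    obtain ⟨⟨σ', τ'⟩, h'⟩ := p
    change σ' = σ at h4
    subst h4
    have h6 : E.total.map ι.op τ' = e :=
      congrArg (fun p : PullbackObj f E (op ⦋0⦌) => p.1.2) h5
    exact Subtype.ext (Prod.ext rfl (h3 τ' ⟨h'.symm, h6⟩))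
  isLocalHomeomorph n := isLocalHomeomorph_fst f E n

/-- The map of pullbacks induced by a morphism of coverings. -/
def PullbackObj.mapHom {X Y : SimplicialObject Profinite.{u}} {f : X ⟶ Y}
    {E E' : FiniteCovering Y} (h : E ⟶ E') {n : SimplexCategoryᵒᵖ} (p : PullbackObj f E n) :
    PullbackObj f E' n :=
  ⟨(p.1.1, h.map.app n p.1.2), p.2.trans (w_apply h n p.1.2).symm⟩

lemma PullbackObj.continuous_mapHom {X Y : SimplicialObject Profinite.{u}} {f : X ⟶ Y}
    {E E' : FiniteCovering Y} (h : E ⟶ E') (n : SimplexCategoryᵒᵖ) :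
    Continuous (PullbackObj.mapHom (f := f) h (n := n)) :=
  ((continuous_fst.prodMk ((h.map.app n).hom.hom.continuous.comp
    continuous_snd)).comp continuous_subtype_val).subtype_mk _

lemma PullbackObj.mapHom_map {X Y : SimplicialObject Profinite.{u}} {f : X ⟶ Y}
    {E E' : FiniteCovering Y} (h : E ⟶ E') {m n : SimplexCategoryᵒᵖ} (θ : m ⟶ n)
    (p : PullbackObj f E m) : mapHom h (map θ p) = map θ (mapHom h p) :=
  Subtype.ext (Prod.ext rfl
    (show h.map.app n (E.total.map θ p.1.2) = E'.total.map θ (h.map.app m p.1.2) from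
      ConcreteCategory.congr_hom (h.map.naturality θ) p.1.2))

/-- The morphism of pullbacks induced by a morphism of coverings. -/
def pullbackMap {X Y : SimplicialObject Profinite.{u}} (f : X ⟶ Y) {E E' : FiniteCovering Y}
    (h : E ⟶ E') : pullback f E ⟶ pullback f E' where
  map :=
    { app := fun n => CompHausLike.ofHom (X := PullbackObj f E n) (Y := PullbackObj f E' n) _
        ⟨PullbackObj.mapHom h, PullbackObj.continuous_mapHom h n⟩
      naturality := fun _ _ θ => ConcreteCategory.hom_ext _ _ fun p =>
        PullbackObj.mapHom_map h θ p }
  w := rfl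

/-- The canonical bijection from the fibre of `E` over `f x` to the fibre of `f^* E` over `x`. -/
def fiberPullback {X Y : SimplicialObject Profinite.{u}} (f : X ⟶ Y) (E : FiniteCovering Y)
    (x : X.obj (op ⦋0⦌)) : E.Fiber (f.app (op ⦋0⦌) x) ≃ (pullback f E).Fiber x where
  toFun e := ⟨(⟨(x, e.1), e.2.symm⟩ : PullbackObj f E (op ⦋0⦌)), rfl⟩
  invFun p := ⟨(pullbackSnd f E).app (op ⦋0⦌) p.1,
    (show PullbackObj f E (op ⦋0⦌) from p.1).2.symm.trans (congrArg (f.app (op ⦋0⦌)) p.2)⟩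
  left_inv _ := rfl
  right_inv p := Subtype.ext (Subtype.ext (Prod.ext p.2.symm rfl))

end FiniteCovering

open FiniteCovering

/-- The profinite fundamental groupoid `Π X`: its objects are the vertices of `X`. -/
@[ext]
structure FundGroupoid (X : SimplicialObject Profinite.{u}) where
  /-- The vertex. -/
  pt : X.obj (op ⦋0⦌)

namespace FundGroupoid

/-- The morphisms of `Π X` from `x` to `y` are the isomorphisms between the fibre functors of the
finite coverings of `X` at `x` and at `y`; equivalently, the isomorphisms over `X` between the
universal profinite coverings at `x` and at `y`. -/
instance (X : SimplicialObject Profinite.{u}) : Groupoid (FundGroupoid X) where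
  Hom x y := fiberFunctor x.pt ≅ fiberFunctor y.pt
  id _ := Iso.refl _
  comp γ δ := γ ≪≫ δ
  inv γ := γ.symm

/-- The action of a morphism `x → y` of `Π X` on the fibres of a covering. -/
def act {X : SimplicialObject Profinite.{u}} {x y : FundGroupoid X} (γ : x ⟶ y)
    (E : FiniteCovering X) (e : E.Fiber x.pt) : E.Fiber y.pt :=
  (show fiberFunctor x.pt ≅ fiberFunctor y.pt from γ).hom.app E e

lemma hom_ext {X : SimplicialObject Profinite.{u}} {x y : FundGroupoid X} {γ δ : x ⟶ y}
    (h : ∀ E e, act γ E e = act δ E e) : γ = δ :=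
  Iso.ext (NatTrans.ext (funext fun E => FintypeCat.hom_ext _ _ fun e => h E e))

lemma act_naturality {X : SimplicialObject Profinite.{u}} {x y : FundGroupoid X}
    (γ : x ⟶ y) {E E' : FiniteCovering X} (h : E ⟶ E') (e : E.Fiber x.pt) :
    act γ E' (fiberMap h e) = fiberMap h (act γ E e) :=
  ConcreteCategory.congr_hom
    ((show fiberFunctor x.pt ≅ fiberFunctor y.pt from γ).hom.naturality h) e

/-- The bijection of fibres given by a morphism of `Π X`. -/
def actEquiv {X : SimplicialObject Profinite.{u}} {x y : FundGroupoid X} (γ : x ⟶ y)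
    (E : FiniteCovering X) : E.Fiber x.pt ≃ E.Fiber y.pt where
  toFun := act γ E
  invFun := act (Groupoid.inv γ) E
  left_inv e := ConcreteCategory.congr_hom (NatTrans.congr_app
    (show fiberFunctor x.pt ≅ fiberFunctor y.pt from γ).hom_inv_id E) e
  right_inv e := ConcreteCategory.congr_hom (NatTrans.congr_app
    (show fiberFunctor x.pt ≅ fiberFunctor y.pt from γ).inv_hom_id E) e

/-- A morphism of `Π X` from a natural family of bijections of fibres. -/
def ofEquiv {X : SimplicialObject Profinite.{u}} {x y : FundGroupoid X}
    (φ : ∀ E : FiniteCovering X, E.Fiber x.pt ≃ E.Fiber y.pt)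
    (hφ : ∀ (E E' : FiniteCovering X) (h : E ⟶ E') (e : E.Fiber x.pt),
      φ E' (fiberMap h e) = fiberMap h (φ E e)) : x ⟶ y :=
  NatIso.ofComponents (F := fiberFunctor x.pt) (G := fiberFunctor y.pt)
    (fun E => FintypeCat.equivEquivIso (A := FintypeCat.of (E.Fiber x.pt))
      (B := FintypeCat.of (E.Fiber y.pt)) (φ E))
    (fun {E E'} h => FintypeCat.hom_ext _ _ fun e => hφ E E' h e)

/-- The functor `Π X ⥤ Π Y` induced by a map of profinite spaces `f`: it sends an isomorphism of
fibre functors to the isomorphism of their compositions with the pullback of coverings along `f`.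
-/
def map {X Y : SimplicialObject Profinite.{u}} (f : X ⟶ Y) :
    FundGroupoid X ⥤ FundGroupoid Y where
  obj x := ⟨f.app (op ⦋0⦌) x.pt⟩
  map {x y} γ := ofEquiv
    (fun E => (fiberPullback f E x.pt).trans
      ((actEquiv γ (pullback f E)).trans (fiberPullback f E y.pt).symm))
    (fun E E' h e => congrArg (fiberPullback f E' y.pt).symm
      (act_naturality γ (pullbackMap f h) (fiberPullback f E x.pt e)))
  map_id _ := hom_ext fun _ _ => rfl
  map_comp {x y z} γ δ := hom_ext fun E e =>
    (congrArg (fun p => (fiberPullback f E z.pt).symm (act δ (pullback f E) p))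
      ((fiberPullback f E y.pt).apply_symm_apply
        (act γ (pullback f E) (fiberPullback f E x.pt e)))).symm

end FundGroupoid

open FundGroupoid

/-- The profinite fundamental group `π₁(X, x)`. It carries the topology induced from the product
of the finite discrete groups of permutations of the fibres over `x`. -/
abbrev pi1 (X : SimplicialObject Profinite.{u}) (x : X.obj (op ⦋0⦌)) : Type (u + 1) :=
  Aut (fiberFunctor x)

/-- The homomorphism `π₁(X, x) → π₁(Y, f x)` induced by a map of profinite spaces. -/
def pi1Map {X Y : SimplicialObject Profinite.{u}} (f : X ⟶ Y) (x : X.obj (op ⦋0⦌)) :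
    pi1 X x →* pi1 Y (f.app (op ⦋0⦌) x) where
  toFun γ := (FundGroupoid.map f).map (X := ⟨x⟩) (Y := ⟨x⟩) γ
  map_one' := (FundGroupoid.map f).map_id ⟨x⟩
  map_mul' γ δ := (FundGroupoid.map f).map_comp (X := ⟨x⟩) (Y := ⟨x⟩) (Z := ⟨x⟩) δ γ

open PreGaloisCategory in
lemma continuous_aut_of_factors {C D : Type*} [Category C] [Category D] (F : C ⥤ FintypeCat.{u})
    (F' : D ⥤ FintypeCat.{u}) (φ : Aut F → Aut F')
    (h : ∀ d, ∃ c, ∃ g : Aut (F.obj c) → Aut (F'.obj d), ∀ γ : Aut F,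
      Iso.app (φ γ) d = g (Iso.app γ c)) : Continuous φ := by
  refine continuous_induced_rng.mpr (continuous_pi fun d => ?_)
  obtain ⟨c, g, hg⟩ := h d
  have h' : Continuous fun γ : Aut F => g (autEmbedding F γ c) :=
    (continuous_of_discreteTopology (f := g)).comp
      ((continuous_apply c).comp continuous_induced_dom)
  exact h'.congr fun γ => (hg γ).symm

lemma continuous_pi1Map {X Y : SimplicialObject Profinite.{u}} (f : X ⟶ Y)
    (x : X.obj (op ⦋0⦌)) : Continuous (pi1Map f x) :=
  continuous_aut_of_factors _ _ _ fun E => ⟨pullback f E, fun σ =>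
    FintypeCat.equivEquivIso (A := FintypeCat.of (E.Fiber (f.app (op ⦋0⦌) x)))
      (B := FintypeCat.of (E.Fiber (f.app (op ⦋0⦌) x)))
      ((fiberPullback f E x).trans ((FintypeCat.equivEquivIso.symm σ).trans
        (fiberPullback f E x).symm)), fun _ => rfl⟩

/-! ### Universal coverings and cohomology with local coefficients -/

/-- The `n`-simplices of the universal profinite covering `(X̃, x)` of `X` at `x`: the limit of
the `n`-simplices of `E` over all pointed finite coverings `(E, e)` of `(X, x)`. -/
@[ext]
structure UniversalCover (X : SimplicialObject Profinite.{u}) (x : X.obj (op ⦋0⦌))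
    (n : SimplexCategoryᵒᵖ) : Type (u + 1) where
  /-- The component in `(E, e)`. -/
  val : ∀ E : FiniteCovering X, E.Fiber x → E.total.obj n
  /-- The components are compatible with the morphisms of pointed coverings. -/
  naturality : ∀ (E E' : FiniteCovering X) (h : E ⟶ E') (e : E.Fiber x),
    h.map.app n (val E e) = val E' (fiberMap h e)

namespace UniversalCover

/-- The limit topology. -/
instance (X : SimplicialObject Profinite.{u}) (x : X.obj (op ⦋0⦌)) (n : SimplexCategoryᵒᵖ) :
    TopologicalSpace (UniversalCover X x n) :=
  TopologicalSpace.induced val inferInstance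

lemma continuous_val {X : SimplicialObject Profinite.{u}} {x : X.obj (op ⦋0⦌)}
    {n : SimplexCategoryᵒᵖ} (E : FiniteCovering X) (e : E.Fiber x) :
    Continuous fun t : UniversalCover X x n => t.val E e :=
  (continuous_apply e).comp ((continuous_apply E).comp continuous_induced_dom)

/-- The simplicial structure of the universal covering. -/
def map {X : SimplicialObject Profinite.{u}} {x : X.obj (op ⦋0⦌)} {m n : SimplexCategoryᵒᵖ}
    (θ : m ⟶ n) (t : UniversalCover X x m) : UniversalCover X x n where
  val E e := E.total.map θ (t.val E e)
  naturality E E' h e := by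
    rw [← t.naturality E E' h e]
    exact ConcreteCategory.congr_hom (h.map.naturality θ) (t.val E e)

lemma map_id {X : SimplicialObject Profinite.{u}} {x : X.obj (op ⦋0⦌)} {n : SimplexCategoryᵒᵖ}
    (t : UniversalCover X x n) : map (𝟙 n) t = t :=
  UniversalCover.ext (funext fun E => funext fun e =>
    ConcreteCategory.congr_hom (E.total.map_id n) (t.val E e))

lemma map_comp {X : SimplicialObject Profinite.{u}} {x : X.obj (op ⦋0⦌)}
    {l m n : SimplexCategoryᵒᵖ} (θ : l ⟶ m) (η : m ⟶ n) (t : UniversalCover X x l) :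
    map (θ ≫ η) t = map η (map θ t) :=
  UniversalCover.ext (funext fun E => funext fun e =>
    ConcreteCategory.congr_hom (E.total.map_comp θ η) (t.val E e))

lemma continuous_map {X : SimplicialObject Profinite.{u}} {x : X.obj (op ⦋0⦌)}
    {m n : SimplexCategoryᵒᵖ} (θ : m ⟶ n) : Continuous (map (x := x) θ) :=
  continuous_induced_rng.mpr (continuous_pi fun E => continuous_pi fun e =>
    (E.total.map θ).hom.hom.continuous.comp (continuous_val E e))

/-- The isomorphism `(X̃, x) → (X̃, y)` over `X` attached to a morphism `x → y` of `Π X`. -/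
def transport {X : SimplicialObject Profinite.{u}} {x y : FundGroupoid X} (γ : x ⟶ y)
    {n : SimplexCategoryᵒᵖ} (t : UniversalCover X x.pt n) : UniversalCover X y.pt n where
  val E e := t.val E (act (Groupoid.inv γ) E e)
  naturality E E' h e := by rw [t.naturality, act_naturality]

/-- The map of universal coverings induced by a map of profinite spaces. -/
def pushforward {X Y : SimplicialObject Profinite.{u}} (f : X ⟶ Y) {x : X.obj (op ⦋0⦌)}
    {n : SimplexCategoryᵒᵖ} (t : UniversalCover X x n) :
    UniversalCover Y (f.app (op ⦋0⦌) x) n where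
  val E e := (pullbackSnd f E).app n (t.val (pullback f E) (fiberPullback f E x e))
  naturality E E' h e := by
    exact congrArg ((pullbackSnd f E').app n)
      (t.naturality _ _ (pullbackMap f h) (fiberPullback f E x e))

lemma continuous_pushforward {X Y : SimplicialObject Profinite.{u}} (f : X ⟶ Y)
    {x : X.obj (op ⦋0⦌)} {n : SimplexCategoryᵒᵖ} :
    Continuous (pushforward f (x := x) (n := n)) :=
  continuous_induced_rng.mpr (continuous_pi fun E => continuous_pi fun _ =>
    ((pullbackSnd f E).app n).hom.hom.continuous.comp (continuous_val (pullback f E) _))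

lemma pushforward_map {X Y : SimplicialObject Profinite.{u}} (f : X ⟶ Y)
    {x : X.obj (op ⦋0⦌)} {m n : SimplexCategoryᵒᵖ} (θ : m ⟶ n) (t : UniversalCover X x m) :
    pushforward f (map θ t) = map θ (pushforward f t) := rfl

lemma pushforward_transport {X Y : SimplicialObject Profinite.{u}} (f : X ⟶ Y)
    {x y : FundGroupoid X} (γ : x ⟶ y) {n : SimplexCategoryᵒᵖ}
    (t : UniversalCover X x.pt n) :
    pushforward f (transport γ t) =
      transport ((FundGroupoid.map f).map γ) (pushforward f (x := x.pt) t) := by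
  ext E e
  have h : fiberPullback f E x.pt (act (Groupoid.inv ((FundGroupoid.map f).map γ)) E e) =
      act (Groupoid.inv γ) (pullback f E) (fiberPullback f E y.pt e) :=
    (fiberPullback f E x.pt).apply_symm_apply _
  exact congrArg (fun p => (pullbackSnd f E).app n (t.val (pullback f E) p)) h.symm

end UniversalCover

/-- A local coefficient system of finite abelian groups on `X`: a functor from `Π X` to finite
abelian groups such that `π₁(X, x)` acts continuously on the discrete group `M(x)` for every
vertex `x`. -/
structure LocalSystem (X : SimplicialObject Profinite.{u}) where
  /-- The functor. -/
  toFunctor : FundGroupoid X ⥤ AddCommGrpCat.{u}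
  /-- Its values are finite. -/
  finite : ∀ x, Finite (toFunctor.obj x)
  /-- The action of the fundamental groups is continuous. -/
  continuous : ∀ (x : X.obj (op ⦋0⦌)) (m : toFunctor.obj ⟨x⟩),
    IsLocallyConstant fun γ : pi1 X x => toFunctor.map (X := ⟨x⟩) (Y := ⟨x⟩) γ m

namespace LocalSystem

/-- The pullback of a local coefficient system along a map of profinite spaces. -/
def pullback {X Y : SimplicialObject Profinite.{u}} (f : X ⟶ Y) (M : LocalSystem Y) :
    LocalSystem X where
  toFunctor := FundGroupoid.map f ⋙ M.toFunctor
  finite x := M.finite ((FundGroupoid.map f).obj x)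
  continuous x m := by
    exact (M.continuous (f.app (op ⦋0⦌) x) m).comp_continuous (continuous_pi1Map f x)

/-- The group `hom_{Π X}((X̃, -)ₙ, M)` of continuous natural transformations from the
`n`-simplices of the universal coverings to the discrete groups `M(-)`. -/
def cochains {X : SimplicialObject Profinite.{u}} (M : LocalSystem X) (n : SimplexCategory) :
    AddSubgroup (∀ x : FundGroupoid X, UniversalCover X x.pt (op n) → M.toFunctor.obj x) where
  carrier := {α | (∀ x, IsLocallyConstant (α x)) ∧
    ∀ (x y : FundGroupoid X) (γ : x ⟶ y) (t : UniversalCover X x.pt (op n)),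
      α y (t.transport γ) = M.toFunctor.map γ (α x t)}
  zero_mem' := ⟨fun _ => IsLocallyConstant.const 0, fun _ _ _ _ => (map_zero _).symm⟩
  add_mem' {α β} hα hβ := ⟨fun x => (hα.1 x).add (hβ.1 x), fun x y γ t => by
    change α y _ + β y _ = M.toFunctor.map γ (α x t + β x t)
    rw [hα.2, hβ.2, map_add]⟩
  neg_mem' {α} hα := ⟨fun x => (hα.1 x).neg, fun x y γ t => by
    change -α y _ = M.toFunctor.map γ (-α x t)
    rw [hα.2, map_neg]⟩

/-- The map of cochain groups induced by an operator `θ : [m] → [n]`. -/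
def cochainsMap {X : SimplicialObject Profinite.{u}} (M : LocalSystem X) {m n : SimplexCategory}
    (θ : m ⟶ n) : M.cochains m →+ M.cochains n where
  toFun α := ⟨fun x t => α.1 x (t.map θ.op),
    fun x => (α.2.1 x).comp_continuous (UniversalCover.continuous_map θ.op),
    fun x y γ t => α.2.2 x y γ (t.map θ.op)⟩
  map_zero' := rfl
  map_add' _ _ := rfl

/-- The cosimplicial abelian group of cochains. -/
def cosimplicialCochains {X : SimplicialObject Profinite.{u}} (M : LocalSystem X) :
    CosimplicialObject AddCommGrpCat.{u + 1} where
  obj n := AddCommGrpCat.of (M.cochains n)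
  map θ := AddCommGrpCat.ofHom (M.cochainsMap θ)
  map_id _ := AddCommGrpCat.hom_ext <| AddMonoidHom.ext fun α => Subtype.ext <|
    funext fun x => funext fun t => congrArg (α.1 x) (UniversalCover.map_id t)
  map_comp θ η := AddCommGrpCat.hom_ext <| AddMonoidHom.ext fun α => Subtype.ext <|
    funext fun x => funext fun t => congrArg (α.1 x) (UniversalCover.map_comp η.op θ.op t)

/-- The complex of continuous cochains with coefficients in `M`, with differential
`∑ (-1)ⁱ dᵢ^*`. -/
abbrev cochainComplex {X : SimplicialObject Profinite.{u}} (M : LocalSystem X) :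
    CochainComplex AddCommGrpCat.{u + 1} ℕ :=
  (AlgebraicTopology.alternatingCofaceMapComplex _).obj M.cosimplicialCochains

/-- The continuous cohomology `H^q(X; M)` with coefficients in a local system. -/
abbrev cohomology {X : SimplicialObject Profinite.{u}} (M : LocalSystem X) (q : ℕ) :
    AddCommGrpCat.{u + 1} :=
  M.cochainComplex.homology q

/-- The map of cochain groups induced by a map of profinite spaces. -/
def cochainsPullback {X Y : SimplicialObject Profinite.{u}} (f : X ⟶ Y) (M : LocalSystem Y)
    (n : SimplexCategory) : M.cochains n →+ (M.pullback f).cochains n where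
  toFun α := ⟨fun x t => α.1 ((FundGroupoid.map f).obj x) (t.pushforward f),
    fun _ => (α.2.1 _).comp_continuous (UniversalCover.continuous_pushforward f),
    fun _ _ γ t => (congrArg (α.1 _) (UniversalCover.pushforward_transport f γ t)).trans
      (α.2.2 _ _ ((FundGroupoid.map f).map γ) (t.pushforward f))⟩
  map_zero' := rfl
  map_add' _ _ := rfl

/-- The map `f^*` on the cochain complexes. -/
def cochainComplexMap {X Y : SimplicialObject Profinite.{u}} (f : X ⟶ Y) (M : LocalSystem Y) :
    M.cochainComplex ⟶ (M.pullback f).cochainComplex :=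
  (AlgebraicTopology.alternatingCofaceMapComplex _).map
    { app := fun n => AddCommGrpCat.ofHom (cochainsPullback f M n)
      naturality := fun _ _ θ => AddCommGrpCat.hom_ext <| AddMonoidHom.ext fun α =>
        Subtype.ext <| funext fun _ => funext fun t =>
          congrArg (α.1 _) (UniversalCover.pushforward_map f θ.op t).symm }

/-- The map `f^* : H^q(Y; M) → H^q(X; f^* M)`. -/
abbrev cohomologyMap {X Y : SimplicialObject Profinite.{u}} (f : X ⟶ Y) (M : LocalSystem Y)
    (q : ℕ) : M.cohomology q ⟶ (M.pullback f).cohomology q :=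
  HomologicalComplex.homologyMap (cochainComplexMap f M) q

end LocalSystem

/-- Weak equivalences of profinite spaces: isomorphisms on `π₀`, on the profinite fundamental
groups at all vertices, and on the cohomology with coefficients in all local systems of finite
abelian groups on the target. -/
structure IsWeakEquivalence {X Y : SimplicialObject Profinite.{u}} (f : X ⟶ Y) : Prop where
  /-- An isomorphism of profinite sets on `π₀`. -/
  pi0 : IsIso (pi0Map f)
  /-- Isomorphisms of profinite groups on `π₁`. -/
  pi1 : ∀ x : X.obj (op ⦋0⦌), IsHomeomorph (pi1Map f x)
  /-- Isomorphisms in cohomology. -/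
  cohomology : ∀ (M : LocalSystem Y) (q : ℕ), IsIso (LocalSystem.cohomologyMap f M q)

/-! ### Good groups -/

section ContinuousCohomology

variable {k Γ : Type u} [CommRing k] [Group Γ] [TopologicalSpace Γ] [IsTopologicalGroup Γ]

/-- A representation of a topological group is discrete if the action is continuous for the
discrete topology on the module. -/
def IsDiscreteRep (A : Rep.{u} k Γ) : Prop :=
  ∀ a : A, IsLocallyConstant fun g : Γ => A.ρ g a

/-- The continuous inhomogeneous cochains `Γⁿ → A`, for the discrete topology on `A`. -/
def continuousCochains (A : Rep.{u} k Γ) (n : ℕ) : Submodule k ((Fin n → Γ) → A) where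
  carrier := {f | IsLocallyConstant f}
  zero_mem' := IsLocallyConstant.const 0
  add_mem' hf hg := hf.add hg
  smul_mem' c _ hf := hf.comp fun a => c • a

lemma d_mem_continuousCochains {A : Rep.{u} k Γ} (hA : IsDiscreteRep A) (n : ℕ)
    (f : (Fin n → Γ) → A) (hf : f ∈ continuousCochains A n) :
    (inhomogeneousCochains.d A n).hom f ∈ continuousCochains A (n + 1) := by
  let _ : TopologicalSpace A := ⊥
  have _ : DiscreteTopology A := ⟨rfl⟩
  have hf' : Continuous f := IsLocallyConstant.continuous hf
  have hρ : Continuous fun p : Γ × A => A.ρ p.1 p.2 :=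
    continuous_prod_of_discrete_right.mpr fun a => (hA a).continuous
  have h1 : Continuous fun g : Fin (n + 1) → Γ => A.ρ (g 0) (f fun i => g i.succ) :=
    hρ.comp (f := fun g : Fin (n + 1) → Γ => (g 0, f fun i => g i.succ))
      ((continuous_apply _).prodMk (hf'.comp (continuous_pi fun i => continuous_apply _)))
  have h2 : ∀ j : Fin (n + 1), Continuous fun g : Fin (n + 1) → Γ =>
      (Fin.contractNth j (· * ·) g : Fin n → Γ) := by
    refine fun j => continuous_pi fun i => ?_
    unfold Fin.contractNth
    split_ifs
    · exact continuous_apply _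
    · exact (continuous_apply _).mul (continuous_apply _)
    · exact continuous_apply _
  have h3 : Continuous fun g : Fin (n + 1) → Γ => ∑ j : Fin (n + 1),
      (-1 : k) ^ ((j : ℕ) + 1) • f (Fin.contractNth j (· * ·) g) :=
    continuous_finsetSum _ fun j _ =>
      (continuous_of_discreteTopology (f := fun a : A => (-1 : k) ^ ((j : ℕ) + 1) • a)).comp
        (hf'.comp (h2 j))
  exact IsLocallyConstant.iff_continuous _ |>.mpr (h1.add h3)

/-- The differential of the complex of all inhomogeneous cochains, restricted to the continuous
cochains. -/
def continuousD (A : Rep.{u} k Γ) (hA : IsDiscreteRep A) (n : ℕ) :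
    ModuleCat.of k (continuousCochains A n) ⟶ ModuleCat.of k (continuousCochains A (n + 1)) :=
  ModuleCat.ofHom ((inhomogeneousCochains.d A n).hom.restrict (d_mem_continuousCochains hA n))

/-- The complex of continuous inhomogeneous cochains of a topological group with coefficients in
a discrete module: the subcomplex of the complex of all inhomogeneous cochains. -/
def continuousCochainComplex (A : Rep.{u} k Γ) (hA : IsDiscreteRep A) :
    CochainComplex (ModuleCat.{u} k) ℕ :=
  CochainComplex.of (fun n => ModuleCat.of k (continuousCochains A n))
    (continuousD A hA)
    fun n => ModuleCat.hom_ext <| LinearMap.ext fun f : continuousCochains A n => Subtype.ext <|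
      show inhomogeneousCochains.d A (n + 1) (inhomogeneousCochains.d A n f.1) = 0 from
        ConcreteCategory.congr_hom
          (groupCohomology.inhomogeneousCochains.d_comp_d n A) f.1

/-- The inclusion of the continuous cochains into all cochains. -/
def continuousCochainsInclusion (A : Rep.{u} k Γ) (hA : IsDiscreteRep A) :
    continuousCochainComplex A hA ⟶ groupCohomology.inhomogeneousCochains A :=
  CochainComplex.ofHom (fun n => ModuleCat.ofHom (continuousCochains A n).subtype) fun n => by
    rw [groupCohomology.inhomogeneousCochains.d_def]
    have h : (continuousCochainComplex A hA).d n (n + 1) = continuousD A hA n :=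
      CochainComplex.of_d (fun n => ModuleCat.of k (continuousCochains A n)) (continuousD A hA) n
    exact Eq.trans rfl (congrArg (fun d => d ≫ ModuleCat.ofHom
      (continuousCochains A (n + 1)).subtype) h).symm

/-- The continuous cohomology `H^q_cts(Γ; A)` with coefficients in a discrete module. -/
abbrev continuousGroupCohomology (A : Rep.{u} k Γ) (hA : IsDiscreteRep A) (q : ℕ) :
    ModuleCat.{u} k :=
  (continuousCochainComplex A hA).homology q

end ContinuousCohomology

/-- The map `ψ : H^q_cts(Ĝ; M) → H^q(G; M)`, induced by restricting continuous cochains along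
`G → Ĝ`. Here `M` is a discrete `Ĝ`-module, i.e. a representation over the ring of integers
(moved to the universe of `G`). -/
def restrictionMap (G : Type u) [Group G] (M : Rep.{u} (ULift.{u} ℤ) (groupCompletion G))
    (hM : IsDiscreteRep M) (q : ℕ) :
    continuousGroupCohomology M hM q ⟶
      groupCohomology (Rep.res (toGroupCompletion G) M) q :=
  HomologicalComplex.homologyMap (continuousCochainsInclusion M hM ≫
    groupCohomology.cochainsMap (toGroupCompletion G) (𝟙 _)) q

/-- A group `G` is good in the sense of Serre if `ψ : H^q_cts(Ĝ; M) → H^q(G; M)` is an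
isomorphism for every finite discrete `Ĝ`-module `M` and every `q`. -/
def IsGood (G : Type u) [Group G] : Prop :=
  ∀ (M : Rep.{u} (ULift.{u} ℤ) (groupCompletion G)) (_ : Finite M) (hM : IsDiscreteRep M) (q : ℕ),
    IsIso (restrictionMap G M hM q)

end

end ProfiniteSpace

namespace ProfiniteSpace

noncomputable section

/-! ### Vertices and lifts of simplices -/

/-! The spaces $\widehat{BG}$ and $B\hat G$ are treated together. Each has a single vertex, maps to
$B\hat G$, and receives a dense image of $BG$ over $B\hat G$; `DenseModel` records this. Let $X$ be
such a space and $E\to X$ a finite covering. Lifting edges labelled by elements of $G$ makes $G$ act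
on the finite set $E_0$, and the action extends to $\hat G$. By density, the vertices of any simplex
of $E$ are obtained from its vertex $0$ through the labels of its image in $B\hat G$
(`vertex_eq_act`). Conversely every finite quotient $G/N$ is the fibre of a covering pulled back
from $B\hat G$, and these coverings map onto all orbits. A Yoneda argument then shows that every
natural family of maps on fibres is the action of one element of $\hat G$ (`family_eq_act`).

Hence each hom-set of $\Pi X$ is $\hat G$, and $\varphi$ induces the identity of $\hat G$ under
these identifications (`map_toHom`). So $\varphi$ is always an isomorphism on $\pi_1$, and on
$\pi_0$, which is a point on both sides. Only the cohomological condition has content.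

The same Yoneda argument describes an $n$-simplex of the universal covering by a simplex of $X_n$
and an element of $\hat G$. A cochain with coefficients in $\mathcal M$ is therefore a locally
constant function $X_n\to M$, where $M$ is the value of $\mathcal M$ at the vertex, and the
differential is that of inhomogeneous cochains (`cochainValue_d`). For $B\hat G$ these are the
continuous cochains of $\hat G$. For $\widehat{BG}$ they are all functions $G^n\to M$, because $M$
is finite and so every such function extends to the completion of $G^n$. Under these identifications
$\varphi^*$ is restriction along $G\to\hat G$ (`isIso_cohomologyMap_iff`). Since local systems on
$B\hat G$ and finite discrete $\hat G$-modules yield each other, the cohomological condition is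
goodness. -/

lemma map_map_apply (X : SimplicialObject Profinite.{u}) {l m n : SimplexCategory} (η : l ⟶ m)
    (θ : m ⟶ n) (σ : X.obj (op n)) :
    X.map η.op (X.map θ.op σ) = X.map (η ≫ θ).op σ :=
  (ConcreteCategory.congr_hom (X.map_comp θ.op η.op) σ).symm

lemma naturality_apply {X Y : SimplicialObject Profinite.{u}} (f : X ⟶ Y)
    {m n : SimplexCategory} (θ : m ⟶ n) (σ : X.obj (op n)) :
    f.app (op m) (X.map θ.op σ) = Y.map θ.op (f.app (op n) σ) :=
  ConcreteCategory.congr_hom (f.naturality θ.op) σ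

lemma continuous_app {X Y : SimplicialObject Profinite.{u}} (f : X ⟶ Y)
    (n : SimplexCategoryᵒᵖ) : Continuous (f.app n) :=
  (f.app n).hom.hom.continuous

/-- The `i`-th vertex of a simplex. -/
def vertex {X : SimplicialObject Profinite.{u}} {n : SimplexCategory} (i : Fin (n.len + 1))
    (σ : X.obj (op n)) : X.obj (op ⦋0⦌) :=
  X.map (SimplexCategory.const ⦋0⦌ n i).op σ

lemma continuous_vertex {X : SimplicialObject Profinite.{u}} {n : SimplexCategory}
    (i : Fin (n.len + 1)) : Continuous (vertex (X := X) i) :=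
  (X.map (SimplexCategory.const ⦋0⦌ n i).op).hom.hom.continuous

lemma vertex_map {X : SimplicialObject Profinite.{u}} {m n : SimplexCategory} (θ : m ⟶ n)
    (i : Fin (m.len + 1)) (σ : X.obj (op n)) :
    vertex i (X.map θ.op σ) = vertex (θ.toOrderHom i) σ :=
  map_map_apply X _ θ σ

lemma vertex_app {X Y : SimplicialObject Profinite.{u}} (f : X ⟶ Y) {n : SimplexCategory}
    (i : Fin (n.len + 1)) (σ : X.obj (op n)) :
    vertex i (f.app (op n) σ) = f.app (op ⦋0⦌) (vertex i σ) :=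
  (naturality_apply f _ σ).symm

lemma vertex_self {X : SimplicialObject Profinite.{u}} (i : Fin 1) (x : X.obj (op ⦋0⦌)) :
    vertex (n := ⦋0⦌) i x = x := by
  obtain rfl : i = 0 := Subsingleton.elim _ _
  have := ConcreteCategory.congr_hom (X.map_id (op ⦋0⦌)) x
  rw [vertex, SimplexCategory.const_eq_id]
  exact this

namespace FiniteCovering

variable {X : SimplicialObject Profinite.{u}} (E : FiniteCovering X)

lemma eq_of_vertex_eq {n : SimplexCategory} (i : Fin (n.len + 1)) {τ τ' : E.total.obj (op n)}
    (h : E.proj.app (op n) τ = E.proj.app (op n) τ') (hi : vertex i τ = vertex i τ') : τ = τ' := by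
  refine (E.existsUnique_lift n (SimplexCategory.const ⦋0⦌ n i) (E.proj.app (op n) τ)
    (vertex i τ) ?_).unique ⟨rfl, rfl⟩ ⟨h.symm, hi.symm⟩
  exact (vertex_app E.proj i τ).symm

variable [Subsingleton (X.obj (op ⦋0⦌))]

/-- The lift of a simplex with prescribed `i`-th vertex, when `X` has a single vertex. -/
def lift {n : SimplexCategory} (i : Fin (n.len + 1)) (σ : X.obj (op n))
    (e : E.total.obj (op ⦋0⦌)) : E.total.obj (op n) :=
  (E.existsUnique_lift n (SimplexCategory.const ⦋0⦌ n i) σ e (Subsingleton.elim _ _)).choose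

@[simp]
lemma proj_lift {n : SimplexCategory} (i : Fin (n.len + 1)) (σ : X.obj (op n))
    (e : E.total.obj (op ⦋0⦌)) : E.proj.app (op n) (E.lift i σ e) = σ :=
  (E.existsUnique_lift n (SimplexCategory.const ⦋0⦌ n i) σ e
    (Subsingleton.elim _ _)).choose_spec.1.1

@[simp]
lemma vertex_lift {n : SimplexCategory} (i : Fin (n.len + 1)) (σ : X.obj (op n))
    (e : E.total.obj (op ⦋0⦌)) : vertex i (E.lift i σ e) = e :=
  (E.existsUnique_lift n (SimplexCategory.const ⦋0⦌ n i) σ e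
    (Subsingleton.elim _ _)).choose_spec.1.2

lemma eq_lift_iff {n : SimplexCategory} {i : Fin (n.len + 1)} {σ : X.obj (op n)}
    {e : E.total.obj (op ⦋0⦌)} {τ : E.total.obj (op n)} :
    τ = E.lift i σ e ↔ E.proj.app (op n) τ = σ ∧ vertex i τ = e := by
  constructor
  · rintro rfl
    simp
  · rintro ⟨rfl, rfl⟩
    exact E.eq_of_vertex_eq i (by simp) (by simp)

lemma lift_vertex {n : SimplexCategory} (i : Fin (n.len + 1)) (τ : E.total.obj (op n)) :
    E.lift i (E.proj.app (op n) τ) (vertex i τ) = τ :=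
  (E.eq_lift_iff.mpr ⟨rfl, rfl⟩).symm

/-- A simplex of a covering is determined by its projection and one of its vertices. -/
def simplexHomeo {n : SimplexCategory} (i : Fin (n.len + 1)) :
    E.total.obj (op n) ≃ₜ X.obj (op n) × E.total.obj (op ⦋0⦌) :=
  Continuous.homeoOfEquivCompactToT2
    (f := { toFun := fun τ => (E.proj.app (op n) τ, vertex i τ)
            invFun := fun p => E.lift i p.1 p.2
            left_inv := fun τ => E.lift_vertex i τ
            right_inv := fun p => by simp })
    ((continuous_app E.proj _).prodMk (continuous_vertex i))

/-- The lifting property is a pointwise statement. Continuity in the simplex and the vertex comes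
from compactness: lifting inverts a continuous bijection between compact Hausdorff spaces. -/
lemma continuous_lift {n : SimplexCategory} (i : Fin (n.len + 1)) :
    Continuous fun p : X.obj (op n) × E.total.obj (op ⦋0⦌) => E.lift i p.1 p.2 :=
  (E.simplexHomeo i).symm.continuous

/-- Over a single vertex, the whole vertex set of a covering is one fibre. -/
instance : Finite (E.total.obj (op ⦋0⦌)) := by
  by_cases h : Nonempty (E.total.obj (op ⦋0⦌))
  · obtain ⟨e⟩ := h
    exact Finite.of_injective
      (fun e' => (⟨e', Subsingleton.elim _ _⟩ : E.Fiber (E.proj.app (op ⦋0⦌) e)))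
      fun a b hab => congrArg Subtype.val hab
  · exact @Finite.of_subsingleton _ ⟨fun a => (h ⟨a⟩).elim⟩

instance : DiscreteTopology (E.total.obj (op ⦋0⦌)) := inferInstance

lemma map_lift {E E' : FiniteCovering X} (h : E ⟶ E') {n : SimplexCategory}
    (i : Fin (n.len + 1)) (σ : X.obj (op n)) (e : E.total.obj (op ⦋0⦌)) :
    h.map.app (op n) (E.lift i σ e) = E'.lift i σ (h.map.app (op ⦋0⦌) e) := by
  rw [eq_lift_iff, w_apply, proj_lift, vertex_app, vertex_lift]
  exact ⟨rfl, rfl⟩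

end FiniteCovering

open FiniteCovering

/-! ### Extension of homomorphisms to the profinite completion of a group -/

section Group

variable {G : Type u} [Group G]

/-- The finite quotient of the completion attached to a normal subgroup of finite index. -/
abbrev finiteQuotient (N : FiniteIndexNormalSubgroup G) : ProfiniteGrp.{u} :=
  (ProfiniteGrp.ProfiniteCompletion.diagram (GrpCat.of G)).obj N

instance (N : FiniteIndexNormalSubgroup G) : DiscreteTopology (finiteQuotient N) := ⟨rfl⟩

instance (N : FiniteIndexNormalSubgroup G) : Finite (finiteQuotient N) :=
  inferInstanceAs (Finite (G ⧸ N.toSubgroup))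

/-- The class of an element of `G`. -/
def quotientMk (N : FiniteIndexNormalSubgroup G) : G →* finiteQuotient N :=
  QuotientGroup.mk' N.toSubgroup

lemma quotientMk_surjective (N : FiniteIndexNormalSubgroup G) :
    Function.Surjective (quotientMk N) :=
  QuotientGroup.mk_surjective

/-- The projection of the completion onto a finite quotient. -/
def coset (N : FiniteIndexNormalSubgroup G) : groupCompletion G →* finiteQuotient N where
  toFun x := x.1 N
  map_one' := rfl
  map_mul' _ _ := rfl

lemma continuous_coset (N : FiniteIndexNormalSubgroup G) : Continuous (coset N) :=
  (continuous_apply N).comp continuous_subtype_val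

lemma coset_toGroupCompletion (N : FiniteIndexNormalSubgroup G) (g : G) :
    coset N (toGroupCompletion G g) = quotientMk N g := rfl

lemma groupCompletion_ext {x y : groupCompletion G} (h : ∀ N, coset N x = coset N y) : x = y :=
  Subtype.ext (funext h)

lemma denseRange_toGroupCompletion : DenseRange (toGroupCompletion G) :=
  ProfiniteGrp.ProfiniteCompletion.denseRange (GrpCat.of G)

/-- The transition map between finite quotients. -/
def quotientMap {N N' : FiniteIndexNormalSubgroup G} (h : N ≤ N') :
    finiteQuotient N →* finiteQuotient N' :=
  QuotientGroup.map _ _ (MonoidHom.id _) h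

/-- An element of the completion from a compatible family of cosets. -/
def ofCosets (x : ∀ N : FiniteIndexNormalSubgroup G, finiteQuotient N)
    (hx : ∀ (N N' : FiniteIndexNormalSubgroup G) (h : N ≤ N'), quotientMap h (x N) = x N') :
    groupCompletion G :=
  ⟨x, fun {N N'} h => hx N N' h.le⟩

variable {Q : Type u} [Group Q]

/-- The kernel of a homomorphism to a finite group. -/
def finiteKer [Finite Q] (ρ : G →* Q) : FiniteIndexNormalSubgroup G :=
  FiniteIndexNormalSubgroup.ofSubgroup ρ.ker

/-- The factorization of a homomorphism to a finite group through a finite quotient. -/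
def quotientLift (ρ : G →* Q) (N : FiniteIndexNormalSubgroup G) (hN : N.toSubgroup ≤ ρ.ker) :
    finiteQuotient N →* Q :=
  QuotientGroup.lift N.toSubgroup ρ hN

lemma quotientLift_mk (ρ : G →* Q) (N : FiniteIndexNormalSubgroup G)
    (hN : N.toSubgroup ≤ ρ.ker) (g : G) : quotientLift ρ N hN (quotientMk N g) = ρ g := rfl

/-- The extension to the profinite completion of a homomorphism to a finite group. -/
def extendHom [Finite Q] (ρ : G →* Q) : groupCompletion G →* Q :=
  (quotientLift ρ (finiteKer ρ) le_rfl).comp (coset (finiteKer ρ))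

lemma isLocallyConstant_extendHom [Finite Q] (ρ : G →* Q) : IsLocallyConstant (extendHom ρ) :=
  (IsLocallyConstant.iff_continuous _ |>.mpr (continuous_coset (finiteKer ρ))).comp
    (quotientLift ρ (finiteKer ρ) le_rfl)

end Group

/-! ### Profinite spaces between `BG` and `BĜ` -/

/-- A profinite space `X` over `BĜ` with a lift `BG → X` of `BG → BĜ` whose image is dense. -/
structure DenseModel (G : Type u) [Group G] (X : SimplicialObject Profinite.{u}) where
  /-- The map to `BĜ`. -/
  toBar : X ⟶ profiniteClassifyingSpace (groupCompletion G)
  /-- The map from `BG`. -/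
  simplex : ∀ n : SimplexCategory, (Fin n.len → G) → X.obj (op n)
  map_simplex : ∀ {m n : SimplexCategory} (θ : m ⟶ n) (g : Fin n.len → G),
    X.map θ.op (simplex n g) = simplex m (barMap θ g)
  denseRange_simplex : ∀ n, DenseRange (simplex n)
  toBar_simplex : ∀ n g, toBar.app (op n) (simplex n g) = toGroupCompletion G ∘ g

namespace DenseModel

variable {G : Type u} [Group G]

/-- The completion of `BG` as a dense model. -/
def completion : DenseModel G (completion.obj (classifyingSpace G)) where
  toBar := comparison G
  simplex _ g := SetCompletion.unit g
  map_simplex _ _ := rfl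
  denseRange_simplex n := SetCompletion.denseRange_unit (Fin n.len → G)
  toBar_simplex n g := comparison_unit G (op n) g

/-- The classifying space of `Ĝ` as a dense model. -/
def bar : DenseModel G (profiniteClassifyingSpace (groupCompletion G)) where
  toBar := 𝟙 _
  simplex _ g := toGroupCompletion G ∘ g
  map_simplex θ g := barMap_hom (toGroupCompletion G) θ g
  denseRange_simplex _ := DenseRange.piMap fun _ => denseRange_toGroupCompletion
  toBar_simplex _ _ := rfl

variable {X : SimplicialObject Profinite.{u}} (S : DenseModel G X)

-- The set $G^0$ has one element, and a dense point in a Hausdorff space is the whole space.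
include S in
lemma subsingleton : Subsingleton (X.obj (op ⦋0⦌)) := by
  have h := S.denseRange_simplex ⦋0⦌
  refine ⟨fun x y => ?_⟩
  have hs : Subsingleton (Fin (SimplexCategory.len ⦋0⦌) → G) :=
    inferInstanceAs (Subsingleton (Fin 0 → G))
  have hc : Set.range (S.simplex ⦋0⦌) = {S.simplex ⦋0⦌ 1} := by
    ext z
    constructor
    · rintro ⟨g, rfl⟩
      exact congrArg _ (Subsingleton.elim _ _)
    · rintro rfl
      exact ⟨1, rfl⟩
  have key : ∀ z, z = S.simplex ⦋0⦌ 1 := fun z => by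
    have := h z
    rwa [hc, closure_singleton] at this
  rw [key x, key y]

/-- The group elements labelling the image of a simplex in `BĜ`. -/
def label {n : SimplexCategory} (σ : X.obj (op n)) : Fin n.len → groupCompletion G :=
  S.toBar.app (op n) σ

lemma continuous_label {n : SimplexCategory} : Continuous (S.label (n := n)) :=
  continuous_app S.toBar (op n)

lemma label_simplex {n : SimplexCategory} (g : Fin n.len → G) :
    S.label (S.simplex n g) = toGroupCompletion G ∘ g :=
  S.toBar_simplex n g

/-- The element of `Ĝ` labelling the path from the vertex `0` to the vertex `i`. -/
def path {n : SimplexCategory} (σ : X.obj (op n)) (i : Fin (n.len + 1)) : groupCompletion G :=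
  Fin.partialProd (S.label σ) i

lemma continuous_partialProd {Γ : Type u} [Group Γ] [TopologicalSpace Γ] [IsTopologicalGroup Γ]
    {n : ℕ} (i : Fin (n + 1)) : Continuous fun g : Fin n → Γ => Fin.partialProd g i := by
  induction i using Fin.induction with
  | zero => simpa using continuous_const
  | succ i ih =>
    simp only [Fin.partialProd_succ]
    exact ih.mul (continuous_apply i)

lemma continuous_path {n : SimplexCategory} (i : Fin (n.len + 1)) :
    Continuous fun σ : X.obj (op n) => S.path σ i :=
  (continuous_partialProd i).comp S.continuous_label

@[simp]
lemma path_zero {n : SimplexCategory} (σ : X.obj (op n)) : S.path σ 0 = 1 :=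
  Fin.partialProd_zero _

lemma partialProd_hom_comp {Γ Δ : Type u} [Group Γ] [Group Δ] (f : Γ →* Δ) {n : ℕ}
    (g : Fin n → Γ) (i : Fin (n + 1)) : Fin.partialProd (f ∘ g) i = f (Fin.partialProd g i) := by
  induction i using Fin.induction with
  | zero => simp
  | succ i ih => simp [Fin.partialProd_succ, ih]

lemma path_simplex {n : SimplexCategory} (g : Fin n.len → G) (i : Fin (n.len + 1)) :
    S.path (S.simplex n g) i = toGroupCompletion G (Fin.partialProd g i) := by
  rw [path, label_simplex, partialProd_hom_comp]

/-! ### The action on the fibres of coverings -/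

section Action

variable (E : FiniteCovering X)

/-- Transport of vertices along the edge labelled by `g`, from its end to its start. -/
def smulVertex (g : G) (e : E.total.obj (op ⦋0⦌)) : E.total.obj (op ⦋0⦌) :=
  have := S.subsingleton
  vertex (n := ⦋1⦌) 0 (E.lift (n := ⦋1⦌) 1 (S.simplex ⦋1⦌ fun _ => g) e)

/-- The edge of `τ` from `i` to `j` lies over the edge labelled by the quotient of partial products,
so by uniqueness it is the lift that defines the transport. The laws of an action are special cases.
-/
lemma smulVertex_vertex {n : SimplexCategory} {g : Fin n.len → G} {τ : E.total.obj (op n)}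
    (hτ : E.proj.app (op n) τ = S.simplex n g) {i j : Fin (n.len + 1)} (hij : i ≤ j) :
    S.smulVertex E ((Fin.partialProd g i)⁻¹ * Fin.partialProd g j) (vertex j τ) = vertex i τ := by
  have := S.subsingleton
  let θ : ⦋1⦌ ⟶ n := SimplexCategory.mkOfLe (n := n.len) i j hij
  have hg : barMap θ g = fun _ => (Fin.partialProd g i)⁻¹ * Fin.partialProd g j := by
    funext k
    obtain rfl : k = (0 : Fin 1) := Subsingleton.elim (α := Fin 1) _ _
    rfl
  have h : E.total.map θ.op τ = E.lift (n := ⦋1⦌) 1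
      (S.simplex ⦋1⦌ fun _ => (Fin.partialProd g i)⁻¹ * Fin.partialProd g j) (vertex j τ) := by
    rw [eq_lift_iff, vertex_map, naturality_apply, hτ, S.map_simplex, hg]
    exact ⟨rfl, rfl⟩
  rw [smulVertex, ← h, vertex_map]
  rfl

lemma smulVertex_one (e : E.total.obj (op ⦋0⦌)) : S.smulVertex E 1 e = e := by
  have := S.subsingleton
  -- The edge from the vertex `0` to itself is degenerate and has label `1`.
  have h := S.smulVertex_vertex E (n := ⦋0⦌) (g := 1) (τ := e) (Subsingleton.elim _ _)
    (le_refl 0)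
  rw [vertex_self] at h
  simpa using h

/-- The 2-simplex $(g,h)$ is lifted with last vertex `e`; its edges $12$, $01$ and $02$ have labels
$h$, $g$ and $gh$. Transport goes from the end of an edge to its start, which makes this a left
action. -/
lemma smulVertex_mul (g h : G) (e : E.total.obj (op ⦋0⦌)) :
    S.smulVertex E (g * h) e = S.smulVertex E g (S.smulVertex E h e) := by
  have := S.subsingleton
  let k : Fin (SimplexCategory.len ⦋2⦌) → G := ![g, h]
  have hk1 : Fin.partialProd k (1 : Fin 3) = g := by
    have := Fin.partialProd_succ k (0 : Fin 2)
    simpa [k] using this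
  have hk2 : Fin.partialProd k (2 : Fin 3) = g * h := by
    have := Fin.partialProd_succ k (1 : Fin 2)
    change Fin.partialProd k (2 : Fin 3) = Fin.partialProd k (1 : Fin 3) * h at this
    rw [this, hk1]
  let τ := E.lift (n := ⦋2⦌) (2 : Fin 3) (S.simplex ⦋2⦌ k) e
  have hτ : E.proj.app (op ⦋2⦌) τ = S.simplex ⦋2⦌ k := E.proj_lift _ _ _
  have hτ2 : vertex (n := ⦋2⦌) (2 : Fin 3) τ = e := E.vertex_lift _ _ _
  have h02 := S.smulVertex_vertex E hτ (i := (0 : Fin 3)) (j := (2 : Fin 3)) (by decide)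
  have h12 := S.smulVertex_vertex E hτ (i := (1 : Fin 3)) (j := (2 : Fin 3)) (by decide)
  have h01 := S.smulVertex_vertex E hτ (i := (0 : Fin 3)) (j := (1 : Fin 3)) (by decide)
  have hk0 : Fin.partialProd k (0 : Fin 3) = 1 := Fin.partialProd_zero k
  rw [hk0, hk2, hτ2, inv_one, one_mul] at h02
  rw [hk1, hk2, hτ2, inv_mul_cancel_left] at h12
  rw [hk0, hk1, inv_one, one_mul, ← h12, ← h02] at h01
  exact h01.symm

/-- The action of `G` on the vertices of a covering. -/
def vertexPerm : G →* Equiv.Perm (E.total.obj (op ⦋0⦌)) :=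
  MonoidHom.toHomPerm
    { toFun := fun g => S.smulVertex E g
      map_one' := funext (S.smulVertex_one E)
      map_mul' := fun g h => funext (S.smulVertex_mul E g h) }

lemma vertexPerm_apply (g : G) (e : E.total.obj (op ⦋0⦌)) :
    S.vertexPerm E g e = S.smulVertex E g e := rfl

/-- The action of `Ĝ` on the vertices of a covering. -/
def act : groupCompletion G →* Equiv.Perm (E.total.obj (op ⦋0⦌)) :=
  have := S.subsingleton
  extendHom (S.vertexPerm E)

lemma act_toGroupCompletion (g : G) (e : E.total.obj (op ⦋0⦌)) :
    S.act E (toGroupCompletion G g) e = S.smulVertex E g e := rfl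

lemma isLocallyConstant_act : IsLocallyConstant (S.act E) :=
  have := S.subsingleton
  isLocallyConstant_extendHom (S.vertexPerm E)

lemma continuous_act (e : E.total.obj (op ⦋0⦌)) : Continuous fun x => S.act E x e :=
  ((S.isLocallyConstant_act E).comp fun π => π e).continuous

/-- For simplices coming from $BG$ this is the transport along the edge from `0` to `i`. Both sides
are continuous in the simplex of `X` once the vertex `0` is fixed, so density gives the rest. The
inverse appears because the action runs from the end of a path to its start. -/
lemma vertex_eq_act {n : SimplexCategory} (i : Fin (n.len + 1)) (τ : E.total.obj (op n)) :
    vertex i τ = S.act E (S.path (E.proj.app (op n) τ) i)⁻¹ (vertex 0 τ) := by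
  have := S.subsingleton
  have key : (fun σ : X.obj (op n) => vertex i (E.lift 0 σ (vertex 0 τ))) =
      fun σ => S.act E (S.path σ i)⁻¹ (vertex 0 τ) := by
    refine (S.denseRange_simplex n).equalizer
      ((continuous_vertex i).comp ((E.continuous_lift 0).comp (Continuous.prodMk_left _)))
      ((S.continuous_act E _).comp (S.continuous_path i).inv) (funext fun g => ?_)
    have h := S.smulVertex_vertex E (E.proj_lift 0 (S.simplex n g) (vertex 0 τ)) (Fin.zero_le i)
    rw [Fin.partialProd_zero, inv_one, one_mul, vertex_lift] at h
    simp only [Function.comp_apply, path_simplex, map_inv]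
    rw [Equiv.Perm.eq_inv_iff_eq, act_toGroupCompletion, h]
  have := congrFun key (E.proj.app (op n) τ)
  simp only [lift_vertex] at this
  exact this

/-- A morphism of coverings carries lifts of edges to lifts of edges, which settles elements of $G$;
density and continuity give $\hat G$. -/
lemma map_act {E E' : FiniteCovering X} (h : E ⟶ E') (x : groupCompletion G)
    (e : E.total.obj (op ⦋0⦌)) :
    h.map.app (op ⦋0⦌) (S.act E x e) = S.act E' x (h.map.app (op ⦋0⦌) e) := by
  have := S.subsingleton
  refine congrFun (denseRange_toGroupCompletion.equalizer
    ((continuous_app h.map _).comp (S.continuous_act E e)) (S.continuous_act E' _)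
    (funext fun g => ?_)) x
  simp only [Function.comp_apply, act_toGroupCompletion, smulVertex]
  rw [← map_lift, vertex_app]

end Action

/-- A map of dense models is equivariant for the action on pulled back coverings. -/
lemma pullbackSnd_act {Y : SimplicialObject Profinite.{u}} (T : DenseModel G Y) (f : X ⟶ Y)
    (hf : ∀ n g, f.app (op n) (S.simplex n g) = T.simplex n g) (E : FiniteCovering Y)
    (x : groupCompletion G) (p : (pullback f E).total.obj (op ⦋0⦌)) :
    (pullbackSnd f E).app (op ⦋0⦌) (S.act (pullback f E) x p) =
      T.act E x ((pullbackSnd f E).app (op ⦋0⦌) p) := by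
  have := S.subsingleton
  have := T.subsingleton
  refine congrFun (denseRange_toGroupCompletion.equalizer
    ((continuous_app (pullbackSnd f E) _).comp (S.continuous_act _ p)) (T.continuous_act E _)
    (funext fun g => ?_)) x
  -- For an element of $G$, the second projection takes the lifted edge in the pullback to the
  -- lifted edge in `E`, by uniqueness of lifts.
  have h := proj_lift (pullback f E) (n := ⦋1⦌) 1 (S.simplex ⦋1⦌ fun _ => g) p
  have h' := vertex_lift (pullback f E) (n := ⦋1⦌) 1 (S.simplex ⦋1⦌ fun _ => g) p
  refine (vertex_app (pullbackSnd f E) (n := ⦋1⦌) 0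
    (lift (pullback f E) 1 (S.simplex ⦋1⦌ fun _ => g) p)).symm.trans (congrArg (vertex 0) ?_)
  refine (E.eq_lift_iff (n := ⦋1⦌)).mpr ⟨?_, ?_⟩
  · rw [← hf]
    refine Eq.trans ?_ (congrArg (f.app (op ⦋1⦌)) h)
    exact (Subtype.prop (p := fun q : X.obj (op ⦋1⦌) × E.total.obj (op ⦋1⦌) =>
      f.app (op ⦋1⦌) q.1 = E.proj.app (op ⦋1⦌) q.2) _).symm
  · exact (vertex_app (pullbackSnd f E) 1 _).trans (congrArg ((pullbackSnd f E).app _) h')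

end DenseModel

/-! ### Change of finite quotient, and two auxiliary facts on coverings -/

section Group

variable {G : Type u} [Group G]

lemma quotientMap_coset {N N' : FiniteIndexNormalSubgroup G} (h : N ≤ N')
    (x : groupCompletion G) : quotientMap h (coset N x) = coset N' x :=
  x.2 (homOfLE h)

/-- The extension can be computed in any finite quotient through which `ρ` factors, not only in the
one by its kernel; the transition maps between quotient coverings need this freedom. -/
lemma extendHom_eq_quotientLift {Q : Type u} [Group Q] [Finite Q] (ρ : G →* Q)
    (N : FiniteIndexNormalSubgroup G) (hN : N.toSubgroup ≤ ρ.ker) (x : groupCompletion G) :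
    extendHom ρ x = quotientLift ρ N hN (coset N x) := by
  have hN' : N ≤ finiteKer ρ := hN
  change quotientLift ρ (finiteKer ρ) le_rfl (coset (finiteKer ρ) x) = _
  rw [← quotientMap_coset hN']
  generalize coset N x = c
  obtain ⟨g, rfl⟩ := quotientMk_surjective N c
  rfl

end Group

lemma isLocalHomeomorph_fst_of_discrete {A B : Type*} [TopologicalSpace A] [TopologicalSpace B]
    [DiscreteTopology B] : IsLocalHomeomorph (Prod.fst : A × B → A) := by
  refine IsLocalHomeomorph.mk _ fun p => ⟨
    { toFun := Prod.fst
      invFun := fun x => (x, p.2)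
      source := {q | q.2 = p.2}
      target := Set.univ
      map_source' := fun _ _ => trivial
      map_target' := fun _ _ => rfl
      left_inv' := fun q hq => Prod.ext rfl (Eq.symm hq)
      right_inv' := fun _ _ => rfl
      open_source := (isOpen_discrete {p.2}).preimage continuous_snd
      open_target := isOpen_univ
      continuousOn_toFun := continuous_fst.continuousOn
      continuousOn_invFun := (Continuous.prodMk_left _).continuousOn }, rfl, fun _ _ => rfl⟩

/-- The identity covering. -/
def identityCovering (X : SimplicialObject Profinite.{u}) : FiniteCovering X where
  total := X
  proj := 𝟙 X
  existsUnique_lift _ _ σ _ he := ⟨σ, ⟨rfl, he.symm⟩, fun _ h => h.1⟩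
  isLocalHomeomorph n := (Homeomorph.refl (X.obj n)).isLocalHomeomorph

/-- The projection of a covering as a morphism to the identity covering. -/
def toIdentityCovering {X : SimplicialObject Profinite.{u}} (E : FiniteCovering X) :
    E ⟶ identityCovering X :=
  Hom.mk E.proj (Category.comp_id E.proj)

/-! ### The coverings attached to the finite quotients -/

section Bar

variable {G : Type u} [Group G] (N : FiniteIndexNormalSubgroup G)

/-- The simplicial structure of the covering of `BĜ` with fibre `G/N`. -/
def quotientBarMap {m n : SimplexCategory} (θ : m ⟶ n)
    (p : (Fin n.len → groupCompletion G) × finiteQuotient N) :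
    (Fin m.len → groupCompletion G) × finiteQuotient N :=
  (barMap θ p.1, (coset N (Fin.partialProd p.1 (θ.toOrderHom 0)))⁻¹ * p.2)

lemma continuous_quotientBarMap {m n : SimplexCategory} (θ : m ⟶ n) :
    Continuous (quotientBarMap N θ) :=
  ((continuous_barMap θ).comp continuous_fst).prodMk
    ((((continuous_coset N).comp ((DenseModel.continuous_partialProd _).comp
      continuous_fst)).inv).mul continuous_snd)

/-- The total space of the covering of `BĜ` with fibre `G/N`. -/
def quotientTotal : SimplicialObject Profinite.{u} where
  obj n := Profinite.of ((Fin n.unop.len → groupCompletion G) × finiteQuotient N)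
  map θ := CompHausLike.ofHom _ ⟨quotientBarMap N θ.unop, continuous_quotientBarMap N θ.unop⟩
  map_id n := ConcreteCategory.hom_ext _ _ fun p => Prod.ext (barMap_id p.1) (by
    change (coset N (Fin.partialProd p.1 0))⁻¹ * p.2 = p.2
    rw [Fin.partialProd_zero, map_one, inv_one, one_mul])
  map_comp θ η := ConcreteCategory.hom_ext _ _ fun p =>
    Prod.ext (barMap_comp η.unop θ.unop p.1) (by
      change (coset N (Fin.partialProd p.1 (θ.unop.toOrderHom (η.unop.toOrderHom 0))))⁻¹ * p.2 =
        (coset N (Fin.partialProd (barMap θ.unop p.1) (η.unop.toOrderHom 0)))⁻¹ *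
          ((coset N (Fin.partialProd p.1 (θ.unop.toOrderHom 0)))⁻¹ * p.2)
      rw [partialProd_barMap, map_mul, map_inv, mul_inv_rev, inv_inv, mul_assoc,
        mul_inv_cancel_left])

/-- The covering of `BĜ` with fibre `G/N`. -/
def quotientBarCovering : FiniteCovering (profiniteClassifyingSpace (groupCompletion G)) where
  total := quotientTotal N
  proj :=
    { app := fun n => CompHausLike.ofHom
        (X := (Fin n.unop.len → groupCompletion G) × finiteQuotient N)
        (Y := Fin n.unop.len → groupCompletion G) _ ⟨Prod.fst, continuous_fst⟩
      naturality := fun _ _ _ => rfl }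
  existsUnique_lift n ι σ (e : (Fin 0 → groupCompletion G) × finiteQuotient N) _ := by
    -- The coordinate of a simplex is that of its vertex `0`, and passing to the vertex `ι`
    -- multiplies it on the left by `c⁻¹`. The lift must therefore have coordinate `c * e.2`.
    let c : finiteQuotient N := coset N (Fin.partialProd (n := n.len) σ (ι.toOrderHom 0))
    refine ⟨((σ, c * e.2) : (Fin n.len → groupCompletion G) × finiteQuotient N),
      ⟨rfl, Prod.ext (Subsingleton.elim (α := Fin 0 → groupCompletion G) _ _)
        (inv_mul_cancel_left c e.2)⟩, ?_⟩
    rintro (τ : (Fin n.len → groupCompletion G) × finiteQuotient N) ⟨h1, h2⟩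
    obtain ⟨x, a⟩ := τ
    change x = σ at h1
    subst h1
    refine Prod.ext rfl ?_
    have h3 : c⁻¹ * a = e.2 := congrArg Prod.snd h2
    exact (eq_inv_mul_iff_mul_eq.mp h3.symm).symm
  isLocalHomeomorph n := isLocalHomeomorph_fst_of_discrete
    (A := Fin n.unop.len → groupCompletion G) (B := finiteQuotient N)

end Bar

namespace DenseModel

variable {G : Type u} [Group G] {X : SimplicialObject Profinite.{u}} (S : DenseModel G X)

/-- The covering of `X` with fibre `G/N`. -/
def quotientCovering (N : FiniteIndexNormalSubgroup G) : FiniteCovering X :=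
  pullback S.toBar (quotientBarCovering N)

variable {S} in
/-- The coordinate in `G/N` of a simplex of the covering with fibre `G/N`. -/
def coord {N : FiniteIndexNormalSubgroup G} {n : SimplexCategory}
    (p : (S.quotientCovering N).total.obj (op n)) : finiteQuotient N :=
  (show PullbackObj S.toBar (quotientBarCovering N) (op n) from p).1.2.2

lemma continuous_coord {N : FiniteIndexNormalSubgroup G} {n : SimplexCategory} :
    Continuous (coord (S := S) (N := N) (n := n)) :=
  continuous_snd.comp (continuous_snd.comp continuous_subtype_val)

lemma coord_map {N : FiniteIndexNormalSubgroup G} {m n : SimplexCategory} (θ : m ⟶ n)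
    (p : (S.quotientCovering N).total.obj (op n)) :
    coord ((S.quotientCovering N).total.map θ.op p) =
      (coset N (S.path ((S.quotientCovering N).proj.app (op n) p) (θ.toOrderHom 0)))⁻¹ *
        coord p := by
  obtain ⟨⟨σ, x, a⟩, h⟩ := (show PullbackObj S.toBar (quotientBarCovering N) (op n) from p)
  change S.label σ = x at h
  subst h
  rfl

/-- The vertex of the covering with fibre `G/N` with given coordinate. -/
def quotientVertex (N : FiniteIndexNormalSubgroup G) (a : finiteQuotient N) :
    (S.quotientCovering N).total.obj (op ⦋0⦌) :=
  (⟨(S.simplex ⦋0⦌ 1, (S.label (S.simplex ⦋0⦌ 1), a)), rfl⟩ :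
    PullbackObj S.toBar (quotientBarCovering N) (op ⦋0⦌))

@[simp]
lemma coord_quotientVertex (N : FiniteIndexNormalSubgroup G) (a : finiteQuotient N) :
    coord (S.quotientVertex N a) = a := rfl

/-- Both `X` and $B\hat G$ have one vertex, so only the coordinate in $G/N$ distinguishes vertices
of this covering. -/
lemma quotientVertex_coord {N : FiniteIndexNormalSubgroup G}
    (p : (S.quotientCovering N).total.obj (op ⦋0⦌)) : S.quotientVertex N (coord p) = p := by
  have := S.subsingleton
  exact Subtype.ext (Prod.ext (Subsingleton.elim _ _)
    (Prod.ext (Subsingleton.elim (α := Fin 0 → groupCompletion G) _ _) rfl))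

lemma coord_vertex {N : FiniteIndexNormalSubgroup G} {n : SimplexCategory}
    (i : Fin (n.len + 1)) (p : (S.quotientCovering N).total.obj (op n)) :
    coord (vertex i p) =
      (coset N (S.path ((S.quotientCovering N).proj.app (op n) p) i))⁻¹ * coord p :=
  S.coord_map _ p

/-- Along an edge labelled `g` the coordinate of the end is $g^{-1}$ times that of the start;
transport goes backwards and multiplies by `g`. -/
lemma coord_smulVertex {N : FiniteIndexNormalSubgroup G} (g : G)
    (p : (S.quotientCovering N).total.obj (op ⦋0⦌)) :
    coord (S.smulVertex _ g p) = quotientMk N g * coord p := by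
  have := S.subsingleton
  set τ := lift (n := ⦋1⦌) (S.quotientCovering N) 1 (S.simplex ⦋1⦌ fun _ => g) p with hτ
  have h1 : coord (vertex (n := ⦋1⦌) 1 τ) = coord p := by rw [hτ, vertex_lift]
  have hp : Fin.partialProd (fun _ : Fin 1 => g) 1 = g := by
    have := Fin.partialProd_succ (fun _ : Fin 1 => g) 0
    simpa using this
  change coord (vertex (n := ⦋1⦌) 0 τ) = _
  rw [← h1, coord_vertex, coord_vertex, path_zero, map_one, inv_one, one_mul, hτ, proj_lift,
    path_simplex]
  change _ = quotientMk N g * ((coset N (toGroupCompletion G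
    (Fin.partialProd (fun _ : Fin 1 => g) 1)))⁻¹ * _)
  rw [hp, coset_toGroupCompletion, mul_inv_cancel_left]

lemma coord_act {N : FiniteIndexNormalSubgroup G} (x : groupCompletion G)
    (p : (S.quotientCovering N).total.obj (op ⦋0⦌)) :
    coord (S.act _ x p) = coset N x * coord p := by
  refine congrFun (denseRange_toGroupCompletion.equalizer
    (S.continuous_coord.comp (S.continuous_act _ p))
    ((continuous_coset N).mul continuous_const) (funext fun g => ?_)) x
  exact S.coord_smulVertex g p

section

variable (E : FiniteCovering X)

lemma act_eq_quotientLift (N : FiniteIndexNormalSubgroup G)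
    (hN : N.toSubgroup ≤ (S.vertexPerm E).ker) (x : groupCompletion G) :
    S.act E x = quotientLift (S.vertexPerm E) N hN (coset N x) :=
  have := S.subsingleton
  extendHom_eq_quotientLift _ N hN x

/-- The morphism from the covering with fibre `G/N` to a covering `E` on which `N` acts trivially,
sending the base point to a given vertex. -/
def fromQuotient (N : FiniteIndexNormalSubgroup G) (hN : N.toSubgroup ≤ (S.vertexPerm E).ker)
    (e : E.total.obj (op ⦋0⦌)) : S.quotientCovering N ⟶ E :=
  have := S.subsingleton
  { map :=
      { app := fun n => CompHausLike.ofHom (X := (S.quotientCovering N).total.obj n) _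
          ⟨fun p => E.lift (n := n.unop) 0 ((S.quotientCovering N).proj.app n p)
              (quotientLift (S.vertexPerm E) N hN (coord (n := n.unop) p) e),
            (E.continuous_lift 0).comp ((continuous_app _ n).prodMk
              ((continuous_of_discreteTopology (f := fun a : finiteQuotient N =>
                quotientLift (S.vertexPerm E) N hN a e)).comp S.continuous_coord))⟩
        naturality := fun m n θ => ConcreteCategory.hom_ext _ _ fun p => by
          change E.lift 0 _ _ = E.total.map θ.unop.op _
          refine Eq.symm ?_
          rw [eq_lift_iff]
          change _ ∧ vertex (n := n.unop) 0 (E.total.map θ.unop.op (E.lift (n := m.unop) 0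
            ((S.quotientCovering N).proj.app m p)
            (quotientLift (S.vertexPerm E) N hN (coord (n := m.unop) p) e))) =
            quotientLift (S.vertexPerm E) N hN (coord (n := n.unop)
              ((S.quotientCovering N).total.map θ.unop.op p)) e
          constructor
          · exact (naturality_apply E.proj θ.unop _).trans
              ((congrArg (X.map θ.unop.op) (E.proj_lift (n := m.unop) _ _ _)).trans
              (naturality_apply (S.quotientCovering N).proj θ.unop p).symm)
          -- In `E` the initial vertex moves by the inverse of the path to `θ 0`, and in the
          -- quotient covering the coordinate moves by the class of the same element. The two agree
          -- because the action on `E` factors through $G/N$.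
          · rw [vertex_map, vertex_eq_act S, coord_map, map_mul, Equiv.Perm.mul_apply,
              vertex_lift, proj_lift, act_eq_quotientLift S E N hN, map_inv] }
    w := NatTrans.ext (funext fun n => ConcreteCategory.hom_ext _ _ fun p =>
      E.proj_lift (n := n.unop) 0 _ _) }

lemma fromQuotient_quotientVertex (N : FiniteIndexNormalSubgroup G)
    (hN : N.toSubgroup ≤ (S.vertexPerm E).ker) (e : E.total.obj (op ⦋0⦌))
    (a : finiteQuotient N) :
    (S.fromQuotient E N hN e).map.app (op ⦋0⦌) (S.quotientVertex N a) =
      quotientLift (S.vertexPerm E) N hN a e := by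
  have := S.subsingleton
  refine Eq.trans (vertex_self 0 _).symm (vertex_lift E (n := ⦋0⦌) 0 _ _)

/-- The action on $G/N'$ is left translation, which `N` does not feel. This provides the morphisms
from the covering with fibre $G/N$ to the one with fibre $G/N'$. -/
lemma le_ker_quotientCovering {N N' : FiniteIndexNormalSubgroup G} (h : N ≤ N') :
    N.toSubgroup ≤ (S.vertexPerm (S.quotientCovering N')).ker := by
  intro g hg
  refine Equiv.ext fun p => ?_
  rw [← S.quotientVertex_coord (S.vertexPerm _ g p), vertexPerm_apply, coord_smulVertex]
  have : quotientMk N' g = 1 := (QuotientGroup.eq_one_iff g).mpr (h hg)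
  rw [this, one_mul, quotientVertex_coord]
  rfl

end

/-! ### Natural families of maps of fibres -/

section Family

variable {x : X.obj (op ⦋0⦌)} (τ : ∀ E : FiniteCovering X, E.Fiber x → E.total.obj (op ⦋0⦌))

/-- The base point of the covering with fibre `G/N`. -/
def basePoint (x : X.obj (op ⦋0⦌)) (N : FiniteIndexNormalSubgroup G) :
    (S.quotientCovering N).Fiber x :=
  ⟨S.quotientVertex N 1, S.subsingleton.elim _ _⟩

/-- The element of `Ĝ` by which a natural family of maps of fibres acts. -/
def familyElement (hτ : ∀ (E E' : FiniteCovering X) (h : E ⟶ E') (e : E.Fiber x),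
    h.map.app (op ⦋0⦌) (τ E e) = τ E' (fiberMap h e)) : groupCompletion G :=
  ofCosets (fun N => coord (τ (S.quotientCovering N) (S.basePoint x N))) (by
    intro N N' hN
    -- The transition morphism preserves base points, and naturality of `τ` along it is the
    -- compatibility of the cosets.
    let h := S.fromQuotient _ N (S.le_ker_quotientCovering hN) (S.quotientVertex N' 1)
    have hb : fiberMap h (S.basePoint x N) = S.basePoint x N' := Subtype.ext
      ((S.fromQuotient_quotientVertex _ N _ _ 1).trans (by rw [map_one]; rfl))
    rw [← hb, ← hτ, ← S.quotientVertex_coord (τ _ (S.basePoint x N)),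
      fromQuotient_quotientVertex, coord_quotientVertex]
    generalize coord (τ _ (S.basePoint x N)) = c
    obtain ⟨g, rfl⟩ := quotientMk_surjective N c
    rw [quotientLift_mk, vertexPerm_apply, coord_smulVertex, coord_quotientVertex, mul_one]
    rfl)

/-- This is the Yoneda argument: `(E, e)` receives a pointed morphism from the covering with fibre
$G/N$, where $N$ is the kernel of the action on `E`, and naturality determines the family at `e` by
its value at that base point. The maps are not assumed bijective, so the result serves both for
morphisms of $\Pi X$ and for initial vertices of simplices of the universal covering. -/
lemma family_eq_act (hτ : ∀ (E E' : FiniteCovering X) (h : E ⟶ E') (e : E.Fiber x),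
    h.map.app (op ⦋0⦌) (τ E e) = τ E' (fiberMap h e)) (E : FiniteCovering X) (e : E.Fiber x) :
    τ E e = S.act E (S.familyElement τ hτ) e.1 := by
  have := S.subsingleton
  let N := finiteKer (S.vertexPerm E)
  let h := S.fromQuotient E N le_rfl e.1
  have hb : fiberMap h (S.basePoint x N) = e := Subtype.ext
    ((S.fromQuotient_quotientVertex E N _ _ 1).trans (by rw [map_one]; rfl))
  rw [S.act_eq_quotientLift E N le_rfl]
  conv_lhs => rw [← hb, ← hτ, ← S.quotientVertex_coord (τ _ (S.basePoint x N))]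
  exact S.fromQuotient_quotientVertex E N _ _ _

end Family

lemma coord_act_basePoint (x : X.obj (op ⦋0⦌)) (N : FiniteIndexNormalSubgroup G)
    (g : groupCompletion G) : coord (S.act _ g (S.basePoint x N).1) = coset N g := by
  rw [coord_act]
  exact mul_one _

end DenseModel

namespace DenseModel

variable {G : Type u} [Group G] {X : SimplicialObject Profinite.{u}} (S : DenseModel G X)

/-! ### The fundamental groupoid of a dense model -/

/-- The bijection of fibres given by an element of `Ĝ`. -/
def fiberEquiv (g : groupCompletion G) (E : FiniteCovering X) (x y : X.obj (op ⦋0⦌)) :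
    E.Fiber x ≃ E.Fiber y :=
  have := S.subsingleton
  { toFun := fun e => ⟨S.act E g e.1, Subsingleton.elim _ _⟩
    invFun := fun e => ⟨(S.act E g).symm e.1, Subsingleton.elim _ _⟩
    left_inv := fun _ => Subtype.ext (Equiv.symm_apply_apply _ _)
    right_inv := fun _ => Subtype.ext (Equiv.apply_symm_apply _ _) }

/-- The morphism of the fundamental groupoid given by an element of `Ĝ`. -/
def toHom (x y : FundGroupoid X) (g : groupCompletion G) : x ⟶ y :=
  FundGroupoid.ofEquiv (fun E => S.fiberEquiv g E x.pt y.pt)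
    fun _ _ h e => Subtype.ext (S.map_act h g e.1).symm

lemma act_toHom (x y : FundGroupoid X) (g : groupCompletion G) (E : FiniteCovering X)
    (e : E.Fiber x.pt) : (FundGroupoid.act (S.toHom x y g) E e).1 = S.act E g e.1 := rfl

/-- Composition in $\Pi X$ is diagrammatic while $\hat G$ acts on the left, so the order of the
product is reversed. -/
lemma toHom_comp (x y z : FundGroupoid X) (g h : groupCompletion G) :
    S.toHom x y g ≫ S.toHom y z h = S.toHom x z (h * g) :=
  FundGroupoid.hom_ext fun E e => Subtype.ext (by
    change S.act E h (S.act E g e.1) = S.act E (h * g) e.1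
    rw [map_mul, Equiv.Perm.mul_apply])

lemma toHom_one (x : FundGroupoid X) : S.toHom x x 1 = 𝟙 x :=
  FundGroupoid.hom_ext fun E e => Subtype.ext (by
    change S.act E 1 e.1 = e.1
    rw [map_one, Equiv.Perm.one_apply])

/-- The element of `Ĝ` by which a morphism of the fundamental groupoid acts. -/
def ofHom {x y : FundGroupoid X} (γ : x ⟶ y) : groupCompletion G :=
  S.familyElement (fun E e => (FundGroupoid.act γ E e).1) fun _ _ h e =>
    (congrArg Subtype.val (FundGroupoid.act_naturality γ h e)).symm

lemma toHom_ofHom {x y : FundGroupoid X} (γ : x ⟶ y) : S.toHom x y (S.ofHom γ) = γ :=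
  FundGroupoid.hom_ext fun E e => Subtype.ext
    (S.family_eq_act (fun E e => (FundGroupoid.act γ E e).1) _ E e).symm

lemma ofHom_toHom (x y : FundGroupoid X) (g : groupCompletion G) :
    S.ofHom (S.toHom x y g) = g :=
  groupCompletion_ext fun N => S.coord_act_basePoint x.pt N g

lemma toHom_inv (x y : FundGroupoid X) (g : groupCompletion G) :
    Groupoid.inv (S.toHom x y g) = S.toHom y x g⁻¹ := by
  have h := S.toHom_comp x y x g g⁻¹
  rw [inv_mul_cancel, toHom_one] at h
  calc Groupoid.inv (S.toHom x y g)
      = Groupoid.inv (S.toHom x y g) ≫ S.toHom x y g ≫ S.toHom y x g⁻¹ := by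
        rw [h, Category.comp_id]
    _ = S.toHom y x g⁻¹ := by
        rw [← Category.assoc, Groupoid.inv_comp, Category.id_comp]

lemma ofHom_comp {x y z : FundGroupoid X} (γ : x ⟶ y) (δ : y ⟶ z) :
    S.ofHom (γ ≫ δ) = S.ofHom δ * S.ofHom γ := by
  conv_lhs => rw [← S.toHom_ofHom γ, ← S.toHom_ofHom δ, toHom_comp, ofHom_toHom]

lemma ofHom_id (x : FundGroupoid X) : S.ofHom (𝟙 x) = 1 := by
  rw [← S.toHom_one x, ofHom_toHom]

open PreGaloisCategory in
lemma isLocallyConstant_aut_app {C : Type*} [Category C] (F : C ⥤ FintypeCat.{u}) (c : C)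
    (e : F.obj c) : IsLocallyConstant fun γ : Aut F => γ.hom.app c e := by
  have h : Continuous fun γ : Aut F => autEmbedding F γ c :=
    (continuous_apply c).comp continuous_induced_dom
  exact (IsLocallyConstant.iff_continuous _ |>.mpr h).comp fun σ => σ.hom e

lemma isLocallyConstant_act_pi1 {X : SimplicialObject Profinite.{u}} (x : X.obj (op ⦋0⦌))
    (E : FiniteCovering X) (e : E.Fiber x) :
    IsLocallyConstant fun γ : pi1 X x => FundGroupoid.act (x := ⟨x⟩) (y := ⟨x⟩) γ E e :=
  isLocallyConstant_aut_app (fiberFunctor x) E e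

/-- The component at $N$ depends only on the image of one base point of one covering, hence is
locally constant in `γ`. -/
lemma continuous_ofHom (x : X.obj (op ⦋0⦌)) :
    Continuous fun γ : pi1 X x => S.ofHom (x := ⟨x⟩) (y := ⟨x⟩) γ := by
  refine Continuous.subtype_mk (continuous_pi fun N => ?_) _
  exact ((isLocallyConstant_act_pi1 x (S.quotientCovering N) (S.basePoint x N)).comp
    fun e => coord e.1).continuous

/-- The fundamental group of a dense model is `Ĝ`. -/
def pi1Homeo (x : X.obj (op ⦋0⦌)) : pi1 X x ≃ₜ groupCompletion G :=
  Continuous.homeoOfEquivCompactToT2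
    (f := { toFun := fun γ : pi1 X x => S.ofHom (x := ⟨x⟩) (y := ⟨x⟩) γ
            invFun := fun g => (show pi1 X x from S.toHom ⟨x⟩ ⟨x⟩ g)
            left_inv := fun γ => S.toHom_ofHom (x := ⟨x⟩) (y := ⟨x⟩) γ
            right_inv := fun g => S.ofHom_toHom ⟨x⟩ ⟨x⟩ g })
    (S.continuous_ofHom x)

/-- The automorphism group of the fibre functor is compact, so the continuous bijection onto $\hat
G$ is a homeomorphism. -/
lemma continuous_toHom (x : X.obj (op ⦋0⦌)) :
    Continuous fun g => (show pi1 X x from S.toHom ⟨x⟩ ⟨x⟩ g) :=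
  (S.pi1Homeo x).symm.continuous

section Map

variable {Y : SimplicialObject Profinite.{u}} (T : DenseModel G Y) (f : X ⟶ Y)
    (hf : ∀ n g, f.app (op n) (S.simplex n g) = T.simplex n g)

-- Pulling back a covering does not change the action of $\hat G$ on its vertices, by
-- `pullbackSnd_act`.
include hf in
lemma map_toHom (x y : FundGroupoid X) (g : groupCompletion G) :
    (FundGroupoid.map f).map (S.toHom x y g) =
      T.toHom ((FundGroupoid.map f).obj x) ((FundGroupoid.map f).obj y) g :=
  FundGroupoid.hom_ext fun E e => Subtype.ext
    (S.pullbackSnd_act T f hf E g (fiberPullback f E x.pt e).1)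

-- After identifying both fundamental groups with $\hat G$, the induced map is the identity.
include hf in
lemma isHomeomorph_pi1Map (x : X.obj (op ⦋0⦌)) : IsHomeomorph (pi1Map f x) := by
  have h : ⇑(pi1Map f x) = (T.pi1Homeo (f.app (op ⦋0⦌) x)).symm ∘ S.pi1Homeo x := by
    funext γ
    obtain ⟨g, rfl⟩ := (S.pi1Homeo x).symm.surjective γ
    rw [Function.comp_apply, Homeomorph.apply_symm_apply]
    exact S.map_toHom T f hf ⟨x⟩ ⟨x⟩ g
  rw [h]
  exact ((S.pi1Homeo x).trans (T.pi1Homeo _).symm).isHomeomorph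

-- Epimorphisms of profinite sets are surjective, so each coequalizer is a quotient of a one-point
-- set, and both sides are points.
include S T in
lemma isIso_pi0Map : IsIso (pi0Map f) := by
  have key : ∀ {Z : SimplicialObject Profinite.{u}}, DenseModel G Z → Nonempty (pi0 Z) ∧
      Subsingleton (pi0 Z) := by
    intro Z R
    have := R.subsingleton
    have hs : Function.Surjective (Limits.coequalizer.π (Z.δ (0 : Fin 2)) (Z.δ (1 : Fin 2))) :=
      (Profinite.epi_iff_surjective _).mp inferInstance
    exact ⟨⟨Limits.coequalizer.π (Z.δ (0 : Fin 2)) (Z.δ (1 : Fin 2)) (R.simplex ⦋0⦌ 1)⟩,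
      hs.subsingleton⟩
  obtain ⟨⟨a⟩, _⟩ := key S
  obtain ⟨_, _⟩ := key T
  exact CompHausLike.isIso_of_bijective _ ⟨fun _ _ _ => Subsingleton.elim _ _,
    fun b => ⟨a, Subsingleton.elim _ _⟩⟩

end Map

end DenseModel

namespace DenseModel

variable {G : Type u} [Group G] {X : SimplicialObject Profinite.{u}} (S : DenseModel G X)

/-- An element of $\hat G$ is recovered from what it does to the base points of the coverings with
fibres $G/N$; this gives uniqueness in `family_eq_act`. -/
lemma familyElement_eq {x : X.obj (op ⦋0⦌)}
    {τ : ∀ E : FiniteCovering X, E.Fiber x → E.total.obj (op ⦋0⦌)}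
    (hτ : ∀ (E E' : FiniteCovering X) (h : E ⟶ E') (e : E.Fiber x),
      h.map.app (op ⦋0⦌) (τ E e) = τ E' (fiberMap h e))
    {g : groupCompletion G} (hg : ∀ E e, τ E e = S.act E g e.1) : S.familyElement τ hτ = g :=
  groupCompletion_ext fun N => by
    rw [← S.coord_act_basePoint x N g, ← hg]
    rfl

/-! ### Simplices of the universal covering -/

section Universal

variable {n : SimplexCategory}

/-- The section of the universal covering of a dense model sending a simplex to its lifts with
initial vertex the base points. -/
def univSection (x : FundGroupoid X) (σ : X.obj (op n)) : UniversalCover X x.pt (op n) where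
  val E e := have := S.subsingleton; E.lift 0 σ e.1
  naturality E E' h e := by
    have := S.subsingleton
    exact map_lift h 0 σ e.1

lemma univSection_val [Subsingleton (X.obj (op ⦋0⦌))] (x : FundGroupoid X) (σ : X.obj (op n))
    (E : FiniteCovering X) (e : E.Fiber x.pt) : (S.univSection x σ).val E e = E.lift 0 σ e.1 := rfl

lemma continuous_univSection (x : FundGroupoid X) :
    Continuous (S.univSection (n := n) x) :=
  have := S.subsingleton
  continuous_induced_rng.mpr (continuous_pi fun E => continuous_pi fun _ =>
    (E.continuous_lift 0).comp (Continuous.prodMk_left _))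

/-- The simplex of `X` under a simplex of the universal covering. -/
def univProj {x : X.obj (op ⦋0⦌)} (t : UniversalCover X x (op n)) : X.obj (op n) :=
  t.val (identityCovering X) ⟨x, rfl⟩

lemma continuous_univProj {x : X.obj (op ⦋0⦌)} :
    Continuous (univProj (X := X) (x := x) (n := n)) :=
  UniversalCover.continuous_val _ _

/-- Every covering maps to the identity covering, so naturality forces all components of `t` to lie
over one simplex. -/
lemma proj_val {x : X.obj (op ⦋0⦌)} (t : UniversalCover X x (op n)) (E : FiniteCovering X)
    (e : E.Fiber x) : E.proj.app (op n) (t.val E e) = univProj t := by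
  have h := t.naturality E (identityCovering X) (toIdentityCovering E) e
  have he : fiberMap (toIdentityCovering E) e = ⟨x, rfl⟩ := Subtype.ext e.2
  rw [he] at h
  exact h

/-- The element of `Ĝ` describing the initial vertices of a simplex of the universal covering. -/
def univElement {x : X.obj (op ⦋0⦌)} (t : UniversalCover X x (op n)) : groupCompletion G :=
  S.familyElement (fun E e => vertex 0 (t.val E e)) fun E E' h e => by
    rw [← vertex_app, t.naturality]

lemma vertex_val {x : X.obj (op ⦋0⦌)} (t : UniversalCover X x (op n)) (E : FiniteCovering X)
    (e : E.Fiber x) : vertex 0 (t.val E e) = S.act E (S.univElement t) e.1 :=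
  S.family_eq_act (fun E e => vertex 0 (t.val E e)) _ E e

lemma continuous_univElement {x : X.obj (op ⦋0⦌)} :
    Continuous (S.univElement (x := x) (n := n)) := by
  refine Continuous.subtype_mk (continuous_pi fun N => ?_) _
  exact S.continuous_coord.comp ((continuous_vertex 0).comp (UniversalCover.continuous_val _ _))

lemma transport_univSection (x y : FundGroupoid X) (g : groupCompletion G) (σ : X.obj (op n))
    [Subsingleton (X.obj (op ⦋0⦌))] (E : FiniteCovering X) (e : E.Fiber y.pt) :
    ((S.univSection x σ).transport (S.toHom x y g)).val E e = E.lift 0 σ (S.act E g⁻¹ e.1) := by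
  change E.lift 0 σ (FundGroupoid.act (Groupoid.inv (S.toHom x y g)) E e).1 = _
  rw [toHom_inv, act_toHom]

/-- In each covering a simplex is determined by its projection and its initial vertex, and the
latter is given by one element of $\hat G$. Thus every simplex of every universal covering is a
transport of one in the section at `x`. -/
lemma eq_transport_univSection (x y : FundGroupoid X) (t : UniversalCover X y.pt (op n)) :
    t = (S.univSection x (univProj t)).transport (S.toHom x y (S.univElement t)⁻¹) := by
  have := S.subsingleton
  refine UniversalCover.ext (funext fun E => funext fun e => ?_)
  rw [transport_univSection, inv_inv, ← vertex_val, ← proj_val t E e, lift_vertex]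

lemma univProj_univSection (x : FundGroupoid X) (σ : X.obj (op n)) :
    univProj (S.univSection x σ) = σ :=
  have := S.subsingleton
  proj_lift (identityCovering X) 0 σ x.pt

lemma univElement_univSection (x : FundGroupoid X) (σ : X.obj (op n)) :
    S.univElement (S.univSection x σ) = 1 := by
  have := S.subsingleton
  refine S.familyElement_eq _ fun E e => ?_
  rw [univSection_val, vertex_lift, map_one, Equiv.Perm.one_apply]

include S in
lemma univProj_transport {x y : FundGroupoid X} (γ : x ⟶ y) (t : UniversalCover X x.pt (op n)) :
    univProj (t.transport γ) = univProj t := by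
  change t.val (identityCovering X) _ = t.val (identityCovering X) _
  congr 1
  exact Subtype.ext (S.subsingleton.elim _ _)

lemma univElement_transport {x y : FundGroupoid X} (g : groupCompletion G)
    (t : UniversalCover X x.pt (op n)) :
    S.univElement (t.transport (S.toHom x y g)) = S.univElement t * g⁻¹ := by
  refine S.familyElement_eq _ fun E e => ?_
  change vertex 0 (t.val E (FundGroupoid.act (Groupoid.inv (S.toHom x y g)) E e)) = _
  rw [S.vertex_val, toHom_inv, act_toHom, map_mul, Equiv.Perm.mul_apply]

/-- The section does not commute with simplicial operators: after applying `θ` the initial vertex is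
the old vertex `θ 0`, and the path leading to it must be corrected by a transport. This is the
source of the twist in the differential. -/
lemma map_univSection {m : SimplexCategory} (θ : m ⟶ n) (x : FundGroupoid X)
    (σ : X.obj (op n)) :
    (S.univSection x σ).map θ.op = (S.univSection x (X.map θ.op σ)).transport
      (S.toHom x x (S.path σ (θ.toOrderHom 0))) := by
  have := S.subsingleton
  refine UniversalCover.ext (funext fun E => funext fun e => ?_)
  rw [transport_univSection, eq_lift_iff]
  change E.proj.app (op m) (E.total.map θ.op (E.lift 0 σ e.1)) = _ ∧
    vertex 0 (E.total.map θ.op (E.lift 0 σ e.1)) = _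
  rw [naturality_apply, proj_lift, vertex_map, vertex_eq_act S, proj_lift, vertex_lift]
  exact ⟨rfl, rfl⟩

/-- The second projection of a lift in the pulled back covering lies over the image simplex and
starts at the prescribed vertex, so it is the lift there. -/
lemma pushforward_univSection {Y : SimplicialObject Profinite.{u}} (T : DenseModel G Y)
    (f : X ⟶ Y) (x : FundGroupoid X) (σ : X.obj (op n)) :
    (S.univSection x σ).pushforward f =
      T.univSection ((FundGroupoid.map f).obj x) (f.app (op n) σ) := by
  have := S.subsingleton
  have := T.subsingleton
  refine UniversalCover.ext (funext fun E => funext fun e => ?_)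
  refine (E.eq_lift_iff (i := 0)).mpr ?_
  have h := proj_lift (pullback f E) 0 σ (fiberPullback f E x.pt e).1
  have h' := vertex_lift (pullback f E) 0 σ (fiberPullback f E x.pt e).1
  constructor
  · refine Eq.trans ?_ (congrArg (f.app (op n)) h)
    exact (Subtype.prop (p := fun q : X.obj (op n) × E.total.obj (op n) =>
      f.app (op n) q.1 = E.proj.app (op n) q.2) _).symm
  · exact (vertex_app (pullbackSnd f E) 0 _).trans (congrArg ((pullbackSnd f E).app _) h')

end Universal

/-! ### Cochains with local coefficients -/

/-- With `B` discrete, joint continuity on `A × B` can be tested one `b` at a time. It is applied to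
the action of $\hat G$ on coefficients. -/
lemma isLocallyConstant_comp₂ {T A B C : Type*} [TopologicalSpace T] [TopologicalSpace A]
    {f : A → B → C} (hf : ∀ b, IsLocallyConstant fun a => f a b) {u : T → A} (hu : Continuous u)
    {v : T → B} (hv : IsLocallyConstant v) : IsLocallyConstant fun t => f (u t) (v t) := by
  let _ : TopologicalSpace B := ⊥
  have _ : DiscreteTopology B := ⟨rfl⟩
  let _ : TopologicalSpace C := ⊥
  have _ : DiscreteTopology C := ⟨rfl⟩
  have h : Continuous fun p : A × B => f p.1 p.2 :=
    continuous_prod_of_discrete_right.mpr fun b => (hf b).continuous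
  exact IsLocallyConstant.iff_continuous _ |>.mpr (h.comp (hu.prodMk hv.continuous))

section Cochains

variable (M : LocalSystem X) (x : FundGroupoid X) {n : SimplexCategory}

/-- The function on the simplices of `X` given by a cochain with local coefficients. -/
def cochainValue : M.cochains n →+ (X.obj (op n) → M.toFunctor.obj x) where
  toFun α σ := α.1 x (S.univSection x σ)
  map_zero' := rfl
  map_add' _ _ := rfl

lemma cochainValue_apply (α : M.cochains n) (σ : X.obj (op n)) :
    S.cochainValue M x α σ = α.1 x (S.univSection x σ) := rfl

lemma isLocallyConstant_cochainValue (α : M.cochains n) :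
    IsLocallyConstant (S.cochainValue M x α) :=
  (α.2.1 x).comp_continuous (S.continuous_univSection x)

/-- Cochains commute with transport, and transports of the section exhaust all simplices. -/
lemma cochainValue_injective : Function.Injective (S.cochainValue M x (n := n)) := by
  intro α β h
  refine Subtype.ext (funext fun y => funext fun t => ?_)
  rw [S.eq_transport_univSection x y t, α.2.2, β.2.2]
  exact congrArg _ (congrFun h (univProj t))

lemma exists_cochainValue_eq (c : X.obj (op n) → M.toFunctor.obj x) (hc : IsLocallyConstant c) :
    ∃ α, S.cochainValue M x α = c := by
  -- The formula is forced by `eq_transport_univSection` and naturality.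
  refine ⟨⟨fun y t => M.toFunctor.map (S.toHom x y (S.univElement t)⁻¹) (c (univProj t)),
    ⟨fun y => ?_, fun y z γ t => ?_⟩⟩, ?_⟩
  -- There is only one vertex, so local constancy reduces to the continuity of the action of $\pi_1$
  -- at `x`.
  · obtain rfl : x = y := FundGroupoid.ext (S.subsingleton.elim _ _)
    refine isLocallyConstant_comp₂
      (f := fun (g : groupCompletion G) (m : M.toFunctor.obj x) =>
        M.toFunctor.map (S.toHom x x g⁻¹) m) (fun m => ?_)
      S.continuous_univElement (hc.comp_continuous continuous_univProj)
    exact (M.continuous x.pt m).comp_continuous ((S.continuous_toHom x.pt).comp continuous_inv)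
  · obtain ⟨g, rfl⟩ : ∃ g, S.toHom y z g = γ := ⟨_, S.toHom_ofHom γ⟩
    beta_reduce
    rw [univElement_transport, S.univProj_transport, ← ConcreteCategory.comp_apply,
      ← M.toFunctor.map_comp, toHom_comp, mul_inv_rev, inv_inv]
  · funext σ
    rw [cochainValue_apply]
    change M.toFunctor.map (S.toHom x x (S.univElement (S.univSection x σ))⁻¹)
      (c (univProj (S.univSection x σ))) = c σ
    rw [univElement_univSection, univProj_univSection, inv_one, toHom_one,
      CategoryTheory.Functor.map_id]
    rfl

lemma cochainValue_cochainsMap {m : SimplexCategory} (θ : m ⟶ n) (α : M.cochains m)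
    (σ : X.obj (op n)) :
    S.cochainValue M x (M.cochainsMap θ α) σ =
      M.toFunctor.map (S.toHom x x (S.path σ (θ.toOrderHom 0)))
        (S.cochainValue M x α (X.map θ.op σ)) := by
  rw [cochainValue_apply]
  change α.1 x ((S.univSection x σ).map θ.op) = _
  rw [map_univSection, α.2.2]
  rfl

lemma cochainValue_cochainsPullback {Y : SimplicialObject Profinite.{u}} (T : DenseModel G Y)
    (f : X ⟶ Y) (M : LocalSystem Y) (α : M.cochains n) (σ : X.obj (op n)) :
    S.cochainValue (M.pullback f) x (LocalSystem.cochainsPullback f M n α) σ =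
      T.cochainValue M ((FundGroupoid.map f).obj x) α (f.app (op n) σ) :=
  congrArg (α.1 ((FundGroupoid.map f).obj x)) (S.pushforward_univSection T f x σ)

end Cochains

end DenseModel

/-! ### Isomorphisms in homology, in terms of elements -/

section Homology

/-- The condition, in terms of elements, that a map between two complexes `A₁ → A₂ → A₃` and
`B₁ → B₂ → B₃` is an isomorphism in homology. -/
def BijectiveOnHomology {A₁ A₂ A₃ B₁ B₂ B₃ : Type*} [Zero A₃] [Zero B₃] [Sub B₂] (f : A₁ → A₂)
    (g : A₂ → A₃) (f' : B₁ → B₂) (g' : B₂ → B₃) (φ : A₂ → B₂) : Prop :=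
  (∀ z, g z = 0 → (∃ y, f' y = φ z) → ∃ y, f y = z) ∧
    ∀ w, g' w = 0 → ∃ z, g z = 0 ∧ ∃ y, f' y = φ z - w

/-- The statement uses bare additive groups, so that complexes living in different categories and
universes can be compared. -/
lemma BijectiveOnHomology.of_equiv
    {A₁ A₂ A₃ B₁ B₂ B₃ : Type*} [AddGroup A₁] [AddGroup A₂] [AddGroup A₃]
    [AddGroup B₁] [AddGroup B₂] [AddGroup B₃]
    {C₁ C₂ C₃ D₁ D₂ D₃ : Type*} [AddGroup C₁] [AddGroup C₂] [AddGroup C₃]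
    [AddGroup D₁] [AddGroup D₂] [AddGroup D₃]
    {f : A₁ → A₂} {g : A₂ → A₃} {f' : B₁ → B₂} {g' : B₂ → B₃} {φ : A₂ → B₂}
    {k : C₁ → C₂} {l : C₂ → C₃} {k' : D₁ → D₂} {l' : D₂ → D₃} {ψ : C₂ → D₂}
    (a₁ : A₁ ≃+ C₁) (a₂ : A₂ ≃+ C₂) (a₃ : A₃ ≃+ C₃) (b₁ : B₁ ≃+ D₁) (b₂ : B₂ ≃+ D₂)
    (b₃ : B₃ ≃+ D₃) (hf : ∀ x, a₂ (f x) = k (a₁ x)) (hg : ∀ x, a₃ (g x) = l (a₂ x))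
    (hf' : ∀ x, b₂ (f' x) = k' (b₁ x)) (hg' : ∀ x, b₃ (g' x) = l' (b₂ x))
    (hφ : ∀ x, b₂ (φ x) = ψ (a₂ x)) (h : BijectiveOnHomology f g f' g' φ) :
    BijectiveOnHomology k l k' l' ψ := by
  constructor
  · rintro z hz ⟨y, hy⟩
    obtain ⟨z, rfl⟩ := a₂.surjective z
    obtain ⟨y, rfl⟩ := b₁.surjective y
    rw [← hg, map_eq_zero_iff _ a₃.injective] at hz
    rw [← hf', ← hφ] at hy
    obtain ⟨x, rfl⟩ := h.1 z hz ⟨y, b₂.injective hy⟩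
    exact ⟨a₁ x, (hf x).symm⟩
  · intro w hw
    obtain ⟨w, rfl⟩ := b₂.surjective w
    rw [← hg', map_eq_zero_iff _ b₃.injective] at hw
    obtain ⟨z, hz, y, hy⟩ := h.2 w hw
    exact ⟨a₂ z, by rw [← hg, hz, map_zero], b₁ y, by rw [← hf', hy, map_sub, hφ]⟩

lemma bijectiveOnHomology_congr
    {A₁ A₂ A₃ B₁ B₂ B₃ : Type*} [AddGroup A₁] [AddGroup A₂] [AddGroup A₃]
    [AddGroup B₁] [AddGroup B₂] [AddGroup B₃]
    {C₁ C₂ C₃ D₁ D₂ D₃ : Type*} [AddGroup C₁] [AddGroup C₂] [AddGroup C₃]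
    [AddGroup D₁] [AddGroup D₂] [AddGroup D₃]
    {f : A₁ → A₂} {g : A₂ → A₃} {f' : B₁ → B₂} {g' : B₂ → B₃} {φ : A₂ → B₂}
    {k : C₁ → C₂} {l : C₂ → C₃} {k' : D₁ → D₂} {l' : D₂ → D₃} {ψ : C₂ → D₂}
    (a₁ : A₁ ≃+ C₁) (a₂ : A₂ ≃+ C₂) (a₃ : A₃ ≃+ C₃) (b₁ : B₁ ≃+ D₁) (b₂ : B₂ ≃+ D₂)
    (b₃ : B₃ ≃+ D₃) (hf : ∀ x, a₂ (f x) = k (a₁ x)) (hg : ∀ x, a₃ (g x) = l (a₂ x))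
    (hf' : ∀ x, b₂ (f' x) = k' (b₁ x)) (hg' : ∀ x, b₃ (g' x) = l' (b₂ x))
    (hφ : ∀ x, b₂ (φ x) = ψ (a₂ x)) :
    BijectiveOnHomology f g f' g' φ ↔ BijectiveOnHomology k l k' l' ψ := by
  refine ⟨.of_equiv a₁ a₂ a₃ b₁ b₂ b₃ hf hg hf' hg' hφ,
    .of_equiv a₁.symm a₂.symm a₃.symm b₁.symm b₂.symm b₃.symm ?_ ?_ ?_ ?_ ?_⟩
  · exact fun x => a₂.injective (by simp [hf])
  · exact fun x => a₃.injective (by simp [hg])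
  · exact fun x => b₂.injective (by simp [hf'])
  · exact fun x => b₃.injective (by simp [hg'])
  · exact fun x => b₂.injective (by simp [hφ])

variable {C : Type*} [Category* C] {FC : C → C → Type*} {CC : C → Type*}
  [∀ X Y, FunLike (FC X Y) (CC X) (CC Y)] [ConcreteCategory C FC] [HasForget₂ C Ab]

/-- The map of underlying groups of a morphism. -/
abbrev toAbHom {A B : C} (f : A ⟶ B) : (forget₂ C Ab).obj A →+ (forget₂ C Ab).obj B :=
  ((forget₂ C Ab).map f).hom

lemma toAbHom_comp {A B D : C} (f : A ⟶ B) (g : B ⟶ D) (a : (forget₂ C Ab).obj A) :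
    toAbHom (f ≫ g) a = toAbHom g (toAbHom f a) := by
  simp [toAbHom]

variable [Abelian C] [(forget₂ C Ab).Additive] [(forget₂ C Ab).PreservesHomology]

/-- Homology is the cokernel of the map to the cycles, so that sequence is exact, and exactness can
be read on elements. -/
lemma toAbHom_homologyπ_eq_zero_iff (S : ShortComplex C) (z : (forget₂ C Ab).obj S.cycles) :
    toAbHom S.homologyπ z = 0 ↔ ∃ y, toAbHom S.f y = toAbHom S.iCycles z := by
  have hi : Function.Injective (toAbHom S.iCycles) :=
    (Preadditive.mono_iff_injective S.iCycles).mp inferInstance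
  have hex : (ShortComplex.mk S.toCycles S.homologyπ S.toCycles_comp_homologyπ).Exact :=
    ShortComplex.exact_of_g_is_cokernel _ S.homologyIsCokernel
  constructor
  · intro h
    obtain ⟨y, hy⟩ := (ShortComplex.exact_iff_of_hasForget _).mp hex z h
    refine ⟨y, ?_⟩
    rw [← hy, ← S.toCycles_i, toAbHom_comp]
  · rintro ⟨y, hy⟩
    rw [← S.toCycles_i, toAbHom_comp] at hy
    rw [← hi hy, ← toAbHom_comp, S.toCycles_comp_homologyπ]
    simp [toAbHom]

/-- In an abelian category an isomorphism is a mono and an epi. The two halves become: a cycle with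
bounding image bounds, and every cycle of the target is homologous to an image. -/
lemma isIso_homologyMap_iff {S T : ShortComplex C} (φ : S ⟶ T) :
    IsIso (ShortComplex.homologyMap φ) ↔ BijectiveOnHomology (toAbHom S.f) (toAbHom S.g)
      (toAbHom T.f) (toAbHom T.g) (toAbHom φ.τ₂) := by
  have hSπ : Function.Surjective (toAbHom S.homologyπ) :=
    (Preadditive.epi_iff_surjective S.homologyπ).mp inferInstance
  have hTπ : Function.Surjective (toAbHom T.homologyπ) :=
    (Preadditive.epi_iff_surjective T.homologyπ).mp inferInstance
  have hTi : Function.Injective (toAbHom T.iCycles) :=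
    (Preadditive.mono_iff_injective T.iCycles).mp inferInstance
  have hπ : ∀ z, toAbHom (ShortComplex.homologyMap φ) (toAbHom S.homologyπ z) =
      toAbHom T.homologyπ (toAbHom (ShortComplex.cyclesMap φ) z) := fun z => by
    rw [← toAbHom_comp, ← toAbHom_comp, ShortComplex.homologyπ_naturality]
  have hi : ∀ z, toAbHom T.iCycles (toAbHom (ShortComplex.cyclesMap φ) z) =
      toAbHom φ.τ₂ (toAbHom S.iCycles z) := fun z => by
    rw [← toAbHom_comp, ← toAbHom_comp, ShortComplex.cyclesMap_i]
  have hcyc : ∀ (U : ShortComplex C) z, toAbHom U.g (toAbHom U.iCycles z) = 0 := fun U z => by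
    rw [← toAbHom_comp, U.iCycles_g]
    simp [toAbHom]
  have hmk : ∀ (U : ShortComplex C) z, toAbHom U.g z = 0 → ∃ c, toAbHom U.iCycles c = z :=
    fun U z hz => ⟨U.cyclesMk z hz, U.i_cyclesMk z hz⟩
  rw [isIso_iff_mono_and_epi, Preadditive.mono_iff_injective, Preadditive.epi_iff_surjective]
  refine and_congr ?_ ?_
  · change Function.Injective (toAbHom (ShortComplex.homologyMap φ)) ↔ _
    rw [injective_iff_map_eq_zero]
    constructor
    · rintro h z hz ⟨y, hy⟩
      obtain ⟨c, rfl⟩ := hmk S z hz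
      rw [← toAbHom_homologyπ_eq_zero_iff]
      refine h _ ?_
      rw [hπ, toAbHom_homologyπ_eq_zero_iff, hi]
      exact ⟨y, hy⟩
    · intro h a ha
      obtain ⟨c, rfl⟩ := hSπ a
      rw [hπ, toAbHom_homologyπ_eq_zero_iff, hi] at ha
      exact (toAbHom_homologyπ_eq_zero_iff S c).mpr (h _ (hcyc S c) ha)
  · change Function.Surjective (toAbHom (ShortComplex.homologyMap φ)) ↔ _
    constructor
    · intro h w hw
      obtain ⟨d, rfl⟩ := hmk T w hw
      obtain ⟨a, ha⟩ := h (toAbHom T.homologyπ d)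
      obtain ⟨c, rfl⟩ := hSπ a
      refine ⟨toAbHom S.iCycles c, hcyc S c, ?_⟩
      rw [← hi, ← map_sub, ← toAbHom_homologyπ_eq_zero_iff, map_sub, ← hπ, ha, sub_self]
    · intro h b
      obtain ⟨d, rfl⟩ := hTπ b
      obtain ⟨z, hz, hy⟩ := h _ (hcyc T d)
      obtain ⟨c, rfl⟩ := hmk S z hz
      rw [← hi, ← map_sub, ← toAbHom_homologyπ_eq_zero_iff, map_sub, ← hπ, sub_eq_zero] at hy
      exact ⟨_, hy⟩

/-- This lets the elementwise criterion apply to complexes of abelian groups as well as of modules.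
-/
instance : HasForget₂ AddCommGrpCat.{u} AddCommGrpCat.{u} where
  forget₂ := 𝟭 _

instance : (forget₂ AddCommGrpCat.{u} AddCommGrpCat.{u}).Additive :=
  inferInstanceAs (𝟭 AddCommGrpCat.{u}).Additive

instance : (forget₂ AddCommGrpCat.{u} AddCommGrpCat.{u}).PreservesHomology :=
  inferInstanceAs (𝟭 AddCommGrpCat.{u}).PreservesHomology

/-- Two maps of cochain complexes of abelian groups and of modules that agree on underlying groups
are isomorphisms in homology at the same time. -/
lemma isIso_homologyMap_congr {R : Type u} [Ring R] {K L : CochainComplex AddCommGrpCat.{u + 1} ℕ}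
    {K' L' : CochainComplex (ModuleCat.{u} R) ℕ} (φ : K ⟶ L) (ψ : K' ⟶ L')
    (a : ∀ n, K.X n ≃+ K'.X n) (b : ∀ n, L.X n ≃+ L'.X n)
    (ha : ∀ n x, a (n + 1) (K.d n (n + 1) x) = K'.d n (n + 1) (a n x))
    (hb : ∀ n x, b (n + 1) (L.d n (n + 1) x) = L'.d n (n + 1) (b n x))
    (hab : ∀ n x, b n (φ.f n x) = ψ.f n (a n x)) (q : ℕ) :
    IsIso (HomologicalComplex.homologyMap φ q) ↔ IsIso (HomologicalComplex.homologyMap ψ q) := by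
  -- The short complex at `q` uses the differential from the predecessor of `q`; for `q = 0` this is
  -- the zero map from degree `0` to itself. Hence all pairs of degrees are needed, not only
  -- consecutive ones.
  have ha' : ∀ m n x, a n (K.d m n x) = K'.d m n (a m x) := fun m n x => by
    by_cases h : m + 1 = n
    · subst h
      exact ha m x
    · rw [K.shape m n h, K'.shape m n h]
      exact map_zero (a n)
  have hb' : ∀ m n x, b n (L.d m n x) = L'.d m n (b m x) := fun m n x => by
    by_cases h : m + 1 = n
    · subst h
      exact hb m x
    · rw [L.shape m n h, L'.shape m n h]
      exact map_zero (b n)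
  refine (isIso_homologyMap_iff
    ((HomologicalComplex.shortComplexFunctor _ _ q).map φ)).trans
    (Iff.trans ?_ (isIso_homologyMap_iff
      ((HomologicalComplex.shortComplexFunctor _ _ q).map ψ)).symm)
  exact bijectiveOnHomology_congr (a _) (a _) (a _) (b _) (b _) (b _) (ha' _ _) (ha' _ _)
    (hb' _ _) (hb' _ _) (hab q)

end Homology

/-! ### Differentials of cochains -/

lemma barMap_δ_zero {Γ : Type u} [Group Γ] {n : ℕ} (g : Fin (n + 1) → Γ) :
    barMap (m := ⦋n⦌) (n := ⦋n + 1⦌) (SimplexCategory.δ 0) g = fun i => g i.succ :=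
  funext fun i => Fin.partialProd_right_inv g i.succ

/-- The faces after the zeroth are the contractions in the inhomogeneous differential; at the
largest `j` nothing is multiplied and the last entry is dropped. -/
lemma barMap_δ_succ {Γ : Type u} [Group Γ] {n : ℕ} (j : Fin (n + 1)) (g : Fin (n + 1) → Γ) :
    barMap (m := ⦋n⦌) (n := ⦋n + 1⦌) (SimplexCategory.δ j.succ) g =
      j.contractNth (· * ·) g := by
  funext i
  rw [← Fin.inv_partialProd_mul_eq_contractNth, ← Fin.succ_succAbove_succ]
  rfl

/-- Reconciles the signs of group cohomology, scalars in `ULift ℤ`, with the integer signs of the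
alternating coface complex. -/
lemma neg_one_pow_smul_eq {R A : Type*} [Ring R] [AddCommGroup A] {_ : Module R A} (k : ℕ) (a : A) :
    (-1 : R) ^ k • a = (-1 : ℤ) ^ k • a := by
  rcases Nat.even_or_odd k with h | h <;> simp [h.neg_one_pow]

/-- The differential of the complex of cochains with local coefficients. -/
def LocalSystem.differential {X : SimplicialObject Profinite.{u}} (M : LocalSystem X) (n : ℕ) :
    M.cochains ⦋n⦌ →+ M.cochains ⦋n + 1⦌ :=
  (M.cochainComplex.d n (n + 1)).hom

lemma LocalSystem.differential_apply {X : SimplicialObject Profinite.{u}} (M : LocalSystem X)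
    (n : ℕ) (α : M.cochains ⦋n⦌) :
    M.differential n α =
      ∑ i : Fin (n + 2), (-1 : ℤ) ^ (i : ℕ) • M.cochainsMap (SimplexCategory.δ i) α := by
  let A : AddCommGrpCat.{u + 1} := AddCommGrpCat.of (M.cochains ⦋n⦌)
  let B : AddCommGrpCat.{u + 1} := AddCommGrpCat.of (M.cochains ⦋n + 1⦌)
  -- Evaluation at `α` is additive in the morphism, so it passes through the alternating sum.
  let ev : (A ⟶ B) →+ B := ⟨⟨fun f => f.hom α, rfl⟩, fun _ _ => rfl⟩
  have h : M.cochainComplex.d n (n + 1) =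
      ∑ i : Fin (n + 2), (-1 : ℤ) ^ (i : ℕ) • M.cosimplicialCochains.δ i :=
    CochainComplex.of_d (fun n => M.cosimplicialCochains.obj ⦋n⦌) _ n
  rw [LocalSystem.differential, h]
  refine (map_sum ev _ _).trans (Finset.sum_congr rfl fun i _ => ?_)
  exact map_zsmul ev _ _

namespace DenseModel

variable {G : Type u} [Group G] {X : SimplicialObject Profinite.{u}} (S : DenseModel G X)

/-- Only the zeroth face moves the initial vertex, to the vertex `1`; hence only its term carries an
action, by the label of the first edge. -/
lemma cochainValue_d (M : LocalSystem X) (x : FundGroupoid X) {n : ℕ} (α : M.cochains ⦋n⦌)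
    (σ : X.obj (op ⦋n + 1⦌)) :
    S.cochainValue M x (n := ⦋n + 1⦌) (M.differential n α) σ =
      M.toFunctor.map (S.toHom x x (S.path (n := ⦋n + 1⦌) σ (1 : Fin (n + 2))))
        (S.cochainValue M x α (X.map (SimplexCategory.δ (0 : Fin (n + 2))).op σ)) +
      ∑ j : Fin (n + 1), (-1 : ℤ) ^ ((j : ℕ) + 1) •
        S.cochainValue M x α (X.map (SimplexCategory.δ j.succ).op σ) := by
  rw [LocalSystem.differential_apply, map_sum, Finset.sum_apply, Fin.sum_univ_succ]
  simp only [map_zsmul, Pi.smul_apply]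
  congr 1
  · rw [Fin.val_zero, pow_zero, one_smul, cochainValue_cochainsMap]
    rfl
  · refine Finset.sum_congr rfl fun j _ => ?_
    -- These faces keep the vertex `0`, so the correcting path is trivial.
    have h : (SimplexCategory.δ j.succ).toOrderHom 0 = (0 : Fin (n + 2)) :=
      Fin.succAbove_of_castSucc_lt j.succ (0 : Fin (n + 1)) (Fin.succ_pos j)
    rw [Fin.val_succ, cochainValue_cochainsMap, h, path_zero, toHom_one,
      CategoryTheory.Functor.map_id]
    rfl

/-! ### Comparison with group cohomology -/

section Comparison

variable {M : LocalSystem X} {x : FundGroupoid X}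
  {A : Rep.{u} (ULift.{u} ℤ) (groupCompletion G)} (ε : M.toFunctor.obj x ≃+ A)

/-- The inhomogeneous cochain of `G` attached to a cochain with local coefficients. -/
def toInhomogeneous (n : ℕ) : M.cochains ⦋n⦌ →+ ((Fin n → G) → A) where
  toFun α g := ε (S.cochainValue M x α (S.simplex ⦋n⦌ g))
  map_zero' := funext fun _ => by rw [map_zero]; exact map_zero ε
  map_add' α β := funext fun _ => by rw [map_add]; exact map_add ε _ _

lemma toInhomogeneous_apply {n : ℕ} (α : M.cochains ⦋n⦌) (g : Fin n → G) :
    S.toInhomogeneous ε n α g = ε (S.cochainValue M x α (S.simplex ⦋n⦌ g)) := rfl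

lemma toInhomogeneous_d
    (hε : ∀ g m, ε (M.toFunctor.map (S.toHom x x g) m) = A.ρ g (ε m)) {n : ℕ}
    (α : M.cochains ⦋n⦌) :
    S.toInhomogeneous ε (n + 1) (M.differential n α) =
      inhomogeneousCochains.d (Rep.res (toGroupCompletion G) A) n (S.toInhomogeneous ε n α) := by
  funext g
  have h1 : Fin.partialProd g 1 = g 0 := by
    have := Fin.partialProd_succ g 0
    simpa using this
  have hp : S.path (n := ⦋n + 1⦌) (S.simplex ⦋n + 1⦌ g) (1 : Fin (n + 2)) =
      toGroupCompletion G (g 0) := (S.path_simplex (n := ⦋n + 1⦌) g _).trans (congrArg _ h1)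
  rw [toInhomogeneous_apply, cochainValue_d, map_add, hε, map_sum, hp, S.map_simplex,
    barMap_δ_zero]
  refine congrArg₂ (· + ·) rfl (Finset.sum_congr rfl fun j _ => ?_)
  rw [map_zsmul, S.map_simplex, barMap_δ_succ]
  exact (neg_one_pow_smul_eq (R := ULift.{u} ℤ) _ _).symm

/-- A locally constant function on $X_n$ is determined by its values on the dense image of $G^n$. -/
lemma toInhomogeneous_injective (n : ℕ) : Function.Injective (S.toInhomogeneous ε n) := by
  intro α β h
  refine S.cochainValue_injective M x (funext fun σ => ?_)
  let _ : TopologicalSpace (M.toFunctor.obj x) := ⊥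
  have _ : DiscreteTopology (M.toFunctor.obj x) := ⟨rfl⟩
  exact congrFun ((S.denseRange_simplex ⦋n⦌).equalizer
    (S.isLocallyConstant_cochainValue M x α).continuous
    (S.isLocallyConstant_cochainValue M x β).continuous
    (funext fun g => ε.injective (congrFun h g))) σ

end Comparison

/-! ### Cochains of $B\hat G$ as continuous cochains of $\hat G$ -/

section Bar

variable {M : LocalSystem (profiniteClassifyingSpace (groupCompletion G))}
  {y : FundGroupoid (profiniteClassifyingSpace (groupCompletion G))}
  {A : Rep.{u} (ULift.{u} ℤ) (groupCompletion G)} (ε : M.toFunctor.obj y ≃+ A)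

/-- Cochains of `BĜ` with local coefficients are continuous inhomogeneous cochains. -/
def cochainsEquivContinuous (n : ℕ) : M.cochains ⦋n⦌ ≃+ continuousCochains A n :=
  AddEquiv.ofBijective (M := M.cochains ⦋n⦌) (N := continuousCochains A n)
    (F := M.cochains ⦋n⦌ →+ continuousCochains A n)
    { toFun := fun α => (⟨fun g => ε ((bar (G := G)).cochainValue M y α g),
        ((bar (G := G)).isLocallyConstant_cochainValue M y α).comp ε⟩ : continuousCochains A n)
      map_zero' := Subtype.ext (funext fun g => (congrArg ε (congrFun
        (map_zero ((bar (G := G)).cochainValue M y)) g)).trans (map_zero ε))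
      map_add' := fun α β => Subtype.ext (funext fun g => (congrArg ε (congrFun
        (map_add ((bar (G := G)).cochainValue M y) α β) g)).trans (map_add ε _ _)) } (by
    refine ⟨fun α β h => (bar (G := G)).cochainValue_injective M y (funext fun g =>
      ε.injective (congrFun (congrArg Subtype.val h) g)), fun c => ?_⟩
    obtain ⟨α, hα⟩ := (bar (G := G)).exists_cochainValue_eq M y (n := ⦋n⦌)
      (fun g => ε.symm (c.1 g)) (IsLocallyConstant.comp c.2 ε.symm)
    exact ⟨α, Subtype.ext (funext fun g =>
      (congrArg ε (congrFun hα g)).trans (ε.apply_symm_apply _))⟩)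

lemma cochainsEquivContinuous_apply {n : ℕ} (α : M.cochains ⦋n⦌)
    (g : Fin n → groupCompletion G) :
    (cochainsEquivContinuous ε n α).1 g = ε ((bar (G := G)).cochainValue M y α g) := rfl

lemma cochainsEquivContinuous_d
    (hε : ∀ g m, ε (M.toFunctor.map ((bar (G := G)).toHom y y g) m) = A.ρ g (ε m)) {n : ℕ}
    (α : M.cochains ⦋n⦌) :
    (cochainsEquivContinuous ε (n + 1) (M.differential n α)).1 =
      inhomogeneousCochains.d A n (cochainsEquivContinuous ε n α).1 := by
  funext g
  have h1 : Fin.partialProd g 1 = g 0 := by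
    have := Fin.partialProd_succ g 0
    simpa using this
  have hp : (bar (G := G)).path (n := ⦋n + 1⦌) g (1 : Fin (n + 2)) = g 0 := h1
  have h0 : (profiniteClassifyingSpace (groupCompletion G)).map
      (SimplexCategory.δ (0 : Fin (n + 2))).op g = fun i : Fin n => g i.succ := barMap_δ_zero g
  have hj : ∀ j : Fin (n + 1), (profiniteClassifyingSpace (groupCompletion G)).map
      (SimplexCategory.δ j.succ).op g = j.contractNth (· * ·) g := fun j => barMap_δ_succ j g
  rw [cochainsEquivContinuous_apply]
  refine (congrArg ε ((bar (G := G)).cochainValue_d M y α g)).trans ?_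
  rw [map_add, hε, map_sum, hp, h0]
  refine congrArg₂ (· + ·) rfl (Finset.sum_congr rfl fun j _ => ?_)
  rw [map_zsmul, hj]
  exact (neg_one_pow_smul_eq (R := ULift.{u} ℤ) _ _).symm

end Bar

/-! ### Cochains of $\widehat{BG}$ as arbitrary cochains of $G$ -/

section Completion

variable {M : LocalSystem (ProfiniteSpace.completion.obj (classifyingSpace G))}
  {x : FundGroupoid (ProfiniteSpace.completion.obj (classifyingSpace G))}
  {A : Rep.{u} (ULift.{u} ℤ) (groupCompletion G)} (ε : M.toFunctor.obj x ≃+ A)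

/-- A finite discrete set is profinite, so the universal property of the completion applies. Here
finiteness of the coefficients is essential. -/
lemma exists_isLocallyConstant_extension {Z : Type u} {B : Type u} [Finite B] (c : Z → B) :
    ∃ F : SetCompletion Z → B, IsLocallyConstant F ∧ ∀ z, F (SetCompletion.unit z) = c z := by
  let _ : TopologicalSpace B := ⊥
  have _ : DiscreteTopology B := ⟨rfl⟩
  obtain ⟨F, hF⟩ := SetCompletion.exists_extension c
  exact ⟨F, IsLocallyConstant.iff_continuous _ |>.mpr F.continuous, hF⟩

/-- Cochains of the completion of `BG` with local coefficients are inhomogeneous cochains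
of `G`. -/
def cochainsEquivInhomogeneous (n : ℕ) : M.cochains ⦋n⦌ ≃+ ((Fin n → G) → A) :=
  AddEquiv.ofBijective ((completion (G := G)).toInhomogeneous ε n) (by
    refine ⟨(completion (G := G)).toInhomogeneous_injective ε n, fun c => ?_⟩
    have := M.finite x
    obtain ⟨F, hF, hFc⟩ := exists_isLocallyConstant_extension fun g => ε.symm (c g)
    obtain ⟨α, hα⟩ := (completion (G := G)).exists_cochainValue_eq M x (n := ⦋n⦌) F hF
    refine ⟨α, funext fun g => ?_⟩
    rw [toInhomogeneous_apply, hα]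
    exact (congrArg ε (hFc g)).trans (ε.apply_symm_apply _))

end Completion

end DenseModel

/-! ### Local systems on $B\hat G$, discrete modules, and the equivalence with goodness -/

open DenseModel

variable {G : Type u} [Group G]

lemma continuousCochainComplex_d {k Γ : Type u} [CommRing k] [Group Γ] [TopologicalSpace Γ]
    [IsTopologicalGroup Γ] (A : Rep.{u} k Γ) (hA : IsDiscreteRep A) (n : ℕ) :
    (continuousCochainComplex A hA).d n (n + 1) = continuousD A hA n :=
  CochainComplex.of_d (fun n => ModuleCat.of k (continuousCochains A n)) (continuousD A hA) n

/-- If a local coefficient system on `BĜ` corresponds to a discrete module, then the map induced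
by the comparison map in cohomology is an isomorphism if and only if the restriction map is. -/
lemma isIso_cohomologyMap_iff (M : LocalSystem (profiniteClassifyingSpace (groupCompletion G)))
    (x : FundGroupoid (ProfiniteSpace.completion.obj (classifyingSpace G)))
    (A : Rep.{u} (ULift.{u} ℤ) (groupCompletion G)) (hA : IsDiscreteRep A)
    (ε : M.toFunctor.obj ((FundGroupoid.map (comparison G)).obj x) ≃+ A)
    (hε : ∀ g m, ε (M.toFunctor.map ((bar (G := G)).toHom _ _ g) m) = A.ρ g (ε m)) (q : ℕ) :
    IsIso (LocalSystem.cohomologyMap (comparison G) M q) ↔ IsIso (restrictionMap G A hA q) := by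
  let ε' : (M.pullback (comparison G)).toFunctor.obj x ≃+ A := ε
  have hε' : ∀ g m, ε' ((M.pullback (comparison G)).toFunctor.map
      ((DenseModel.completion (G := G)).toHom x x g) m) = A.ρ g (ε' m) := fun g m => by
    refine Eq.trans ?_ (hε g m)
    -- The comparison map is the identity on $\hat G$, so the pulled back system carries the same
    -- action.
    rw [← (DenseModel.completion (G := G)).map_toHom (bar (G := G)) (comparison G)
      fun n g => comparison_unit G (op n) g]
    rfl
  refine isIso_homologyMap_congr (LocalSystem.cochainComplexMap (comparison G) M)
    (continuousCochainsInclusion A hA ≫ groupCohomology.cochainsMap (toGroupCompletion G) (𝟙 _))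
    (fun n => cochainsEquivContinuous ε n) (fun n => cochainsEquivInhomogeneous ε' n)
    (fun n α => ?_) (fun n α => ?_) (fun n α => ?_) q
  · rw [continuousCochainComplex_d]
    exact Subtype.ext (cochainsEquivContinuous_d ε hε α)
  · rw [groupCohomology.inhomogeneousCochains.d_def]
    exact (DenseModel.completion (G := G)).toInhomogeneous_d ε' hε' α
  · funext g
    change ε' ((DenseModel.completion (G := G)).cochainValue (M.pullback (comparison G)) x
      (LocalSystem.cochainsPullback (comparison G) M ⦋n⦌ α) (SetCompletion.unit g)) =
      ε ((bar (G := G)).cochainValue M _ α (toGroupCompletion G ∘ g))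
    refine (congrArg ε' (cochainValue_cochainsPullback _ x (bar (G := G)) (comparison G) M α
      (SetCompletion.unit g))).trans ?_
    -- Pulling back along $\varphi$ and evaluating on $BG$ amounts to evaluating at the image of `g`
    -- in $\hat G^n$, which is restriction of cochains.
    exact congrArg (fun z => ε ((bar (G := G)).cochainValue M _ α z))
      (comparison_unit G (op ⦋n⦌) g)

/-- The discrete module attached to a local coefficient system on `BĜ`. -/
def repOfLocalSystem (M : LocalSystem (profiniteClassifyingSpace (groupCompletion G)))
    (y : FundGroupoid (profiniteClassifyingSpace (groupCompletion G))) :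
    Rep.{u} (ULift.{u} ℤ) (groupCompletion G) :=
  Rep.of (X := M.toFunctor.obj y)
    { toFun := fun g =>
        { toFun := fun m => M.toFunctor.map ((bar (G := G)).toHom y y g) m
          map_add' := fun _ _ => map_add _ _ _
          map_smul' := fun c m => map_zsmul (M.toFunctor.map _).hom c.down m }
      map_one' := LinearMap.ext fun m => by
        change M.toFunctor.map ((bar (G := G)).toHom y y 1) m = m
        rw [toHom_one, CategoryTheory.Functor.map_id]
        rfl
      map_mul' := fun g h => LinearMap.ext fun m => by
        change M.toFunctor.map ((bar (G := G)).toHom y y (g * h)) m =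
          M.toFunctor.map ((bar (G := G)).toHom y y g)
            (M.toFunctor.map ((bar (G := G)).toHom y y h) m)
        rw [← (bar (G := G)).toHom_comp y y y h g, M.toFunctor.map_comp]
        rfl }

/-- Continuity of the $\pi_1$-action transfers along the continuous map from $\hat G$ to $\pi_1$. -/
lemma isDiscreteRep_repOfLocalSystem
    (M : LocalSystem (profiniteClassifyingSpace (groupCompletion G)))
    (y : FundGroupoid (profiniteClassifyingSpace (groupCompletion G))) :
    IsDiscreteRep (repOfLocalSystem M y) := fun m =>
  (M.continuous y.pt m).comp_continuous ((bar (G := G)).continuous_toHom y.pt)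

/-- The local coefficient system on `BĜ` attached to a finite discrete module. -/
def localSystemOfRep (A : Rep.{u} (ULift.{u} ℤ) (groupCompletion G)) (hfin : Finite A)
    (hA : IsDiscreteRep A) : LocalSystem (profiniteClassifyingSpace (groupCompletion G)) where
  toFunctor :=
    { obj := fun _ => AddCommGrpCat.of A
      map := fun γ => AddCommGrpCat.ofHom (A.ρ ((bar (G := G)).ofHom γ)).toAddMonoidHom
      map_id := fun y => AddCommGrpCat.hom_ext <| AddMonoidHom.ext fun m => by
        change A.ρ ((bar (G := G)).ofHom (𝟙 y)) m = m
        rw [ofHom_id, map_one]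
        rfl
      map_comp := fun γ δ => AddCommGrpCat.hom_ext <| AddMonoidHom.ext fun m => by
        change A.ρ ((bar (G := G)).ofHom (γ ≫ δ)) m =
          A.ρ ((bar (G := G)).ofHom δ) (A.ρ ((bar (G := G)).ofHom γ) m)
        rw [ofHom_comp, map_mul]
        rfl }
  finite _ := hfin
  continuous y m := (hA m).comp_continuous ((bar (G := G)).continuous_ofHom y)

/-- The conditions on $\pi_0$ and $\pi_1$ hold for every `G`. What remains is that finite discrete
modules and local systems on $B\hat G$ test the same maps, one construction being used in each
direction. -/
lemma isWeakEquivalence_comparison_iff_isGood (G : Type u) [Group G] :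
    IsWeakEquivalence (comparison G) ↔ IsGood G := by
  have hcomp : ∀ (n : SimplexCategory) (g : Fin n.len → G), (comparison G).app (op n)
      ((DenseModel.completion (G := G)).simplex n g) = (bar (G := G)).simplex n g :=
    fun n g => comparison_unit G (op n) g
  let x : FundGroupoid (ProfiniteSpace.completion.obj (classifyingSpace G)) :=
    ⟨(DenseModel.completion (G := G)).simplex ⦋0⦌ 1⟩
  constructor
  · intro h A hfin hA q
    refine (isIso_cohomologyMap_iff (localSystemOfRep A hfin hA) x A hA (AddEquiv.refl A)
      (fun g m => ?_) q).mp (h.cohomology _ q)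
    change A.ρ ((bar (G := G)).ofHom ((bar (G := G)).toHom _ _ g)) m = A.ρ g m
    rw [ofHom_toHom]
  · intro h
    refine ⟨isIso_pi0Map DenseModel.completion bar _,
      isHomeomorph_pi1Map DenseModel.completion bar _ hcomp, fun M q => ?_⟩
    let y := (FundGroupoid.map (comparison G)).obj x
    exact (isIso_cohomologyMap_iff M x (repOfLocalSystem M y)
      (isDiscreteRep_repOfLocalSystem M y) (AddEquiv.refl _) (fun _ _ => rfl) q).mpr
      (h (repOfLocalSystem M y) (M.finite y) _ q)

end

end ProfiniteSpace

theorem mainTheorem7 (G : Type u) [Group G] :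
    ProfiniteSpace.IsWeakEquivalence (ProfiniteSpace.comparison G) ↔ ProfiniteSpace.IsGood G := by
  exact ProfiniteSpace.isWeakEquivalence_comparison_iff_isGood G
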